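/- **Conventions.** A *positively ordered monoid* (POM) is an abelian monoid $M$ with a partial order such that $a\le b$ implies $a+c\le b+c$, and $0\le a$ for all $a$. A *POM-morphism* is an order-preserving monoid homomorphism; a *POM-bimorphism* $M\times N\to R$ is a map that is a POM-morphism in each variable. An *auxiliary relation* $\prec$ on a POM $S$ satisfies: $a\prec b\Rightarrow a\le b$; $a\le b\prec c\le d\Rightarrow a\prec d$; $0\prec a$ for all $a$. A *PreW-semigroup* is a POM $S$ with an auxiliary relation $\prec$ such that: (W1) for each $a$ there is a sequence $a_k\prec a_{k+1}$ with $a_k\prec a$ for all $k$ such that every $b\prec a$ satisfies $b\prec a_k$ for some $k$; (W3) $a'\prec a$ and $b'\prec b$ imply $a'+b'\prec a+b$; (W4) if $a\prec b+c$, there are $b'\prec b$, $c'\prec c$ with $a\prec b'+c'$. A *generalized W-morphism* $f\colon S\to R$ of PreW-semigroups is a POM-morphism such that $r\prec f(a)$ implies $r\le f(a')$ for some $a'\prec a$; it is a *W-morphism* if moreover $a'\prec a$ implies $f(a')\prec f(a)$. A *generalized W-bimorphism* $f\colon S\times T\to R$ is a POM-bimorphism such that $r\prec f(a,b)$ implies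 $r\le f(a',b')$ for some $a'\prec a$, $b'\prec b$; it is a *W-bimorphism* if moreover $a'\prec a$, $b'\prec b$ imply $f(a',b')\prec f(a,b)$. In a POM, $a\ll b$ means: whenever $(b_n)_n$ is an increasing sequence that has a supremum and $b\le\sup_n b_n$, then $a\le b_k$ for some $k$. A *Cu-semigroup* is a POM such that: (O1) increasing sequences have suprema; (O2) every element is the supremum of a sequence with $a_n\ll a_{n+1}$; (O3) $a'\ll a$, $b'\ll b$ imply $a'+b'\ll a+b$; (O4) $\sup_n(a_n+b_n)=\sup_n a_n+\sup_n b_n$ for increasing sequences. A *generalized Cu-morphism* is a POM-morphism preserving suprema of increasing sequences; a *Cu-morphism* also preserves $\ll$. A *generalized Cu-bimorphism* is a POM-bimorphism with $\sup_k f(a_k,b_k)=f(\sup_k a_k,\sup_k b_k)$ for all increasing sequences; it is a *Cu-bimorphism* if moreover $a'\ll a$, $b'\ll b$ imply $f(a',b')\ll f(a,b)$. Every Cu-semigroup is regarded as equipped with the relation $\ll$. All sets of (generalized) (bi)morphisms are POMs under pointwise addition and order. For generalized morphisms, $f\prec g$ means that $a'\prec a$ implies $f(a')\prec g(a)$; for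 generalized bimorphisms, $f\prec g$ means that $a'\prec a$, $b'\prec b$ imply $f(a',b')\prec g(a,b)$ (with $\ll$ in place of $\prec$ for Cu-semigroups). For POMs $S,T$, let $S\otimes T$ be their tensor product: the quotient, by $f\le g\le f$, of the free abelian monoid $\mathbb N[S\times T]$ on symbols $a\odot b$, with the smallest positive, translation-invariant pre-order $\le$ for which $\odot$ is, modulo $f\le g\le f$, additive in each variable with $a\odot 0=0=0\odot b$, and for which $\odot$ is order-preserving in each variable. Let $\omega(a,b)=a\otimes b$ be the class of $a\odot b$. If $S,T$ carry auxiliary relations, set $x\prec y$ in $S\otimes T$ if there are nonzero $a_j\in S$, $b_j\in T$ $(j\in J$ finite$)$, a subset $J'\subseteq J$ and nonzero $a_j'\prec a_j$, $b_j'\prec b_j$ $(j\in J')$ with $y=\sum_{j\in J}a_j\otimes b_j$ and $x\le\sum_{j\in J'}a_j'\otimes b_j'$. For a PreW-semigroup $P$, let $\gamma(P)$ be the set of $\prec$-increasing sequences in $P$ with pointwise addition, pre-ordered by $(a_k)\subset(b_k)$ iff for every $k$ there is $n$ with $a_k\prec b_n$, modulo the equivalence relation of this pre-order. Let $\alpha\colon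 P\to\gamma(P)$ send $a$ to the class of a sequence as in (W1). **Theorem.** (A) Let $S,T$ be PreW-semigroups. Then $\prec$ is an auxiliary relation on $S\otimes T$, the pair $S\otimes_{\mathrm{PreW}}T:=(S\otimes T,\prec)$ is a PreW-semigroup, and $\omega\colon S\times T\to S\otimes_{\mathrm{PreW}}T$ is a W-bimorphism. For every PreW-semigroup $R$: 1. for every (generalized) W-bimorphism $f\colon S\times T\to R$ there is a (generalized) W-morphism $\tilde f\colon S\otimes_{\mathrm{PreW}}T\to R$ with $f=\tilde f\circ\omega$; 2. for generalized W-morphisms $g_1,g_2\colon S\otimes_{\mathrm{PreW}}T\to R$: $g_1\circ\omega\le g_2\circ\omega$ if and only if $g_1\le g_2$; 3. for such $g_1,g_2$: $g_1\circ\omega\prec g_2\circ\omega$ if and only if $g_1\prec g_2$. Hence $g\mapsto g\circ\omega$ is an isomorphism of POMs from the generalized W-morphisms $S\otimes_{\mathrm{PreW}}T\to R$ onto the generalized W-bimorphisms $S\times T\to R$, which preserves and reflects $\prec$, and it restricts to an isomorphism of POMs from the W-morphisms onto the W-bimorphisms. The latter is natural in $R$, so $(S\otimes_{\mathrm{PreW}}T,\omega)$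 represents the W-bimorphism functor. (B) Let $S,T$ be Cu-semigroups. Then $S\otimes_{\mathrm{PreW}}T$ (formed with respect to $\ll$) is a PreW-semigroup, $S\otimes_{\mathrm{Cu}}T:=\gamma(S\otimes_{\mathrm{PreW}}T)$ is a Cu-semigroup, and $\alpha\colon S\otimes_{\mathrm{PreW}}T\to S\otimes_{\mathrm{Cu}}T$ is a Cu-completion, that is, a W-morphism through which every W-morphism from $S\otimes_{\mathrm{PreW}}T$ to a Cu-semigroup factors by a unique Cu-morphism. The map $\varphi:=\alpha\circ\omega\colon S\times T\to S\otimes_{\mathrm{Cu}}T$ is a Cu-bimorphism. For every Cu-semigroup $R$: 1. for every (generalized) Cu-bimorphism $f\colon S\times T\to R$ there is a (generalized) Cu-morphism $\tilde f\colon S\otimes_{\mathrm{Cu}}T\to R$ with $f=\tilde f\circ\varphi$; 2. for generalized Cu-morphisms $g_1,g_2\colon S\otimes_{\mathrm{Cu}}T\to R$: $g_1\circ\varphi\le g_2\circ\varphi$ if and only if $g_1\le g_2$; 3. for such $g_1,g_2$: $g_1\circ\varphi\prec g_2\circ\varphi$ if and only if $g_1\prec g_2$. Hence $g\mapsto g\circ\varphi$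 is an isomorphism of POMs from the generalized Cu-morphisms $S\otimes_{\mathrm{Cu}}T\to R$ onto the generalized Cu-bimorphisms $S\times T\to R$, which preserves and reflects $\prec$, and it restricts to an isomorphism of POMs from the Cu-morphisms onto the Cu-bimorphisms. The latter is natural in $R$, so $(S\otimes_{\mathrm{Cu}}T,\varphi)$ represents the Cu-bimorphism functor. -/

import Mathlib

universe u v w

/-! ### Positively ordered monoids -/

/-- A positively pre-ordered monoid: an abelian monoid with a translation-invariant pre-order for
which every element is positive. -/
class PrePom (M : Type u) extends AddCommMonoid M, Preorder M, IsOrderedAddMonoid M where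
  nonneg : ∀ a : M, 0 ≤ a

/-- A positively ordered monoid (POM): an abelian monoid with a translation-invariant partial order
for which every element is positive. -/
class Pom (M : Type u) extends AddCommMonoid M, PartialOrder M, IsOrderedAddMonoid M where
  nonneg : ∀ a : M, 0 ≤ a

/-- A POM-morphism: an order-preserving monoid homomorphism. -/
structure IsPomMor {M : Type u} {R : Type v} [Pom M] [Pom R] (f : M → R) : Prop where
  map_zero : f 0 = 0
  map_add : ∀ a b, f (a + b) = f a + f b
  monotone : Monotone f

/-- A POM-bimorphism: a POM-morphism in each variable. -/
structure IsPomBimor {M : Type u} {N : Type v} {R : Type w} [Pom M] [Pom N] [Pom R]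
    (f : M × N → R) : Prop where
  left : ∀ b, IsPomMor fun a => f (a, b)
  right : ∀ a, IsPomMor fun b => f (a, b)

namespace PrePom

variable (M : Type u) [PrePom M]

/-- The congruence `a ≤ b ∧ b ≤ a` on a positively pre-ordered monoid. -/
def symmCon : AddCon M where
  r a b := a ≤ b ∧ b ≤ a
  iseqv := ⟨fun _ => ⟨le_rfl, le_rfl⟩, fun h => ⟨h.2, h.1⟩,
    fun h k => ⟨h.1.trans k.1, k.2.trans h.2⟩⟩
  add' h k := ⟨add_le_add h.1 k.1, add_le_add h.2 k.2⟩

/-- The POM reflection of a positively pre-ordered monoid: the quotient by `a ≤ b ∧ b ≤ a`. -/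
def Reflection : Type u := (symmCon M).Quotient

instance : AddCommMonoid (Reflection M) := inferInstanceAs (AddCommMonoid (symmCon M).Quotient)

variable {M}

/-- The quotient map to the POM reflection. -/
def toReflection (a : M) : Reflection M := ((a : (symmCon M).Quotient))

instance : Pom (Reflection M) where
  le := Quotient.lift₂ (fun a b : M => a ≤ b) (fun _ _ _ _ h k =>
    propext ⟨fun l => (h.2.trans l).trans k.1, fun l => (h.1.trans l).trans k.2⟩)
  le_refl := by rintro ⟨a⟩; exact le_refl (a : M)
  le_trans := by rintro ⟨a⟩ ⟨b⟩ ⟨c⟩ h k; exact le_trans (a := (a : M)) h k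
  le_antisymm := by rintro ⟨a⟩ ⟨b⟩ h k; exact Quotient.sound ⟨h, k⟩
  add_le_add_left := by
    rintro ⟨a⟩ ⟨b⟩ h ⟨c⟩
    have h' : (a : M) ≤ b := h
    exact (add_le_add h' (le_refl c) : (a : M) + c ≤ b + c)
  nonneg := by rintro ⟨a⟩; exact PrePom.nonneg (a : M)

end PrePom

/-! ### The tensor product of positively ordered monoids -/

section PomTensor

variable (S : Type u) (T : Type v) [Pom S] [Pom T]

/-- The free abelian monoid `ℕ[S × T]`. -/
def FreeTensor : Type (max u v) := S × T →₀ ℕ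

noncomputable instance : AddCommMonoid (FreeTensor S T) :=
  inferInstanceAs (AddCommMonoid (S × T →₀ ℕ))

variable {S T}

/-- The generator `a ⊙ b` of the free abelian monoid. -/
noncomputable def FreeTensor.of (a : S) (b : T) : FreeTensor S T :=
  (Finsupp.single (a, b) 1 : S × T →₀ ℕ)

/-- The positive, translation-invariant pre-order on `ℕ[S × T]` generated by additivity of `⊙` in
each variable, `a ⊙ 0 = 0 = 0 ⊙ b`, and monotonicity of `⊙`. -/
inductive FreeTensor.Le : FreeTensor S T → FreeTensor S T → Prop
  | refl (f) : Le f f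
  | trans {f g h} : Le f g → Le g h → Le f h
  | add {f f' g g'} : Le f f' → Le g g' → Le (f + g) (f' + g')
  | nonneg (f) : Le 0 f
  | zero_left (b) : Le (of 0 b) 0
  | zero_right (a) : Le (of a 0) 0
  | split_left (a a' b) : Le (of (a + a') b) (of a b + of a' b)
  | join_left (a a' b) : Le (of a b + of a' b) (of (a + a') b)
  | split_right (a b b') : Le (of a (b + b')) (of a b + of a b')
  | join_right (a b b') : Le (of a b + of a b') (of a (b + b'))
  | mono {a a' b b'} : a ≤ a' → b ≤ b' → Le (of a b) (of a' b')

noncomputable instance : PrePom (FreeTensor S T) where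
  le := FreeTensor.Le
  le_refl := .refl
  le_trans _ _ _ := .trans
  add_le_add_left _ _ h c := .add h (.refl c)
  nonneg := .nonneg

variable (S T)

/-- The tensor product `S ⊗ T` of positively ordered monoids. -/
def PomTensor : Type (max u v) := PrePom.Reflection (FreeTensor S T)

noncomputable instance : Pom (PomTensor S T) :=
  inferInstanceAs (Pom (PrePom.Reflection (FreeTensor S T)))

/-- The universal POM-bimorphism `ω : S × T → S ⊗ T`, `(a, b) ↦ a ⊗ b`. -/
noncomputable def pomTensorMap (p : S × T) : PomTensor S T :=
  PrePom.toReflection (FreeTensor.of p.1 p.2)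

end PomTensor

/-! ### PreW-semigroups, W-morphisms and W-bimorphisms -/

/-- `r` is an auxiliary relation on the positively ordered monoid `S`. -/
structure IsAuxiliary {S : Type u} [Pom S] (r : S → S → Prop) : Prop where
  le : ∀ {a b}, r a b → a ≤ b
  mono : ∀ {a b c d}, a ≤ b → r b c → c ≤ d → r a d
  zero : ∀ a, r 0 a

/-- `(S, r)` is a PreW-semigroup: `r` is an auxiliary relation with (W1), (W3) and (W4). -/
structure IsPreW {S : Type u} [Pom S] (r : S → S → Prop) : Prop extends IsAuxiliary r where
  w1 : ∀ a, ∃ x : ℕ → S, (∀ k, r (x k) a) ∧ (∀ k, r (x k) (x (k + 1))) ∧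
    ∀ b, r b a → ∃ k, r b (x k)
  w3 : ∀ {a' a b' b}, r a' a → r b' b → r (a' + b') (a + b)
  w4 : ∀ {a b c}, r a (b + c) → ∃ b' c', r a (b' + c') ∧ r b' b ∧ r c' c

section WMor

variable {S : Type u} {T : Type v} {R : Type w} [Pom S] [Pom T] [Pom R]
  {rS : S → S → Prop} {rT : T → T → Prop} {rR : R → R → Prop}

/-- A generalized W-morphism `(S, rS) → (R, rR)`: a continuous POM-morphism. -/
structure IsGenWMor (rS : S → S → Prop) (rR : R → R → Prop) (f : S → R) : Prop
    extends IsPomMor f where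
  cont : ∀ a b, rR b (f a) → ∃ a', rS a' a ∧ b ≤ f a'

/-- A W-morphism: a generalized W-morphism that preserves the auxiliary relation. -/
structure IsWMor (rS : S → S → Prop) (rR : R → R → Prop) (f : S → R) : Prop
    extends IsGenWMor rS rR f where
  map_rel : ∀ a' a, rS a' a → rR (f a') (f a)

/-- A generalized W-bimorphism `S × T → R`: a (jointly) continuous POM-bimorphism. -/
structure IsGenWBimor (rS : S → S → Prop) (rT : T → T → Prop) (rR : R → R → Prop)
    (f : S × T → R) : Prop extends IsPomBimor f where
  cont : ∀ a b r, rR r (f (a, b)) → ∃ a' b', rS a' a ∧ rT b' b ∧ r ≤ f (a', b')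

/-- A W-bimorphism: a generalized W-bimorphism that jointly preserves the auxiliary relations. -/
structure IsWBimor (rS : S → S → Prop) (rT : T → T → Prop) (rR : R → R → Prop)
    (f : S × T → R) : Prop extends IsGenWBimor rS rT rR f where
  map_rel : ∀ a' a b' b, rS a' a → rT b' b → rR (f (a', b')) (f (a, b))

/-- The relation `f ≺ g` between (generalized) morphisms. -/
def MorRel (rS : S → S → Prop) (rR : R → R → Prop) (f g : S → R) : Prop :=
  ∀ a' a, rS a' a → rR (f a') (g a)

/-- The relation `f ≺ g` between (generalized) bimorphisms. -/
def BimorRel (rS : S → S → Prop) (rT : T → T → Prop) (rR : R → R → Prop)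
    (f g : S × T → R) : Prop :=
  ∀ a' a b' b, rS a' a → rT b' b → rR (f (a', b')) (g (a, b))

theorem isPomMor_zero : IsPomMor (0 : S → R) :=
  ⟨rfl, fun _ _ => (add_zero (0 : R)).symm, fun _ _ _ => le_refl (0 : R)⟩

theorem IsPomMor.add {f g : S → R} (hf : IsPomMor f) (hg : IsPomMor g) : IsPomMor (f + g) where
  map_zero := by simp [hf.map_zero, hg.map_zero]
  map_add a b := by simp only [Pi.add_apply, hf.map_add, hg.map_add]; exact add_add_add_comm ..
  monotone _ _ h := add_le_add (hf.monotone h) (hg.monotone h)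

theorem isPomBimor_zero : IsPomBimor (0 : S × T → R) :=
  ⟨fun _ => isPomMor_zero, fun _ => isPomMor_zero⟩

theorem IsPomBimor.add {f g : S × T → R} (hf : IsPomBimor f) (hg : IsPomBimor g) :
    IsPomBimor (f + g) :=
  ⟨fun b => (hf.left b).add (hg.left b), fun a => (hf.right a).add (hg.right a)⟩

theorem IsPomMor.comp {g : S → R} {f : T → S} (hg : IsPomMor g) (hf : IsPomMor f) :
    IsPomMor (g ∘ f) where
  map_zero := by simp [hf.map_zero, hg.map_zero]
  map_add a b := by simp [hf.map_add, hg.map_add]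
  monotone := hg.monotone.comp hf.monotone

theorem IsPomBimor.monotone {f : S × T → R} (hf : IsPomBimor f) : Monotone f :=
  fun p q h => ((hf.left p.2).monotone h.1).trans ((hf.right q.1).monotone h.2)

theorem IsPreW.directed (hS : IsPreW rS) {a x y : S} (hx : rS x a) (hy : rS y a) :
    ∃ z, rS z a ∧ x ≤ z ∧ y ≤ z := by
  obtain ⟨s, hs, hs', hc⟩ := hS.w1 a
  have hm : Monotone s := monotone_nat_of_le_succ fun k => hS.le (hs' k)
  obtain ⟨i, hi⟩ := hc x hx
  obtain ⟨j, hj⟩ := hc y hy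
  exact ⟨s (max i j), hs _, (hS.le hi).trans (hm (le_max_left ..)),
    (hS.le hj).trans (hm (le_max_right ..))⟩

/-- The generalized W-morphisms, as a monoid under pointwise addition (ordered pointwise). -/
def GenWMor (hS : IsPreW rS) (hR : IsPreW rR) : AddSubmonoid (S → R) where
  carrier := {f | IsGenWMor rS rR f}
  zero_mem' := ⟨isPomMor_zero, fun a _ h => ⟨0, hS.zero a, hR.le h⟩⟩
  add_mem' {f g} hf hg := ⟨hf.toIsPomMor.add hg.toIsPomMor, fun a b h => by
    obtain ⟨x, y, hb, hx, hy⟩ := hR.w4 h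
    obtain ⟨a₁, h₁, l₁⟩ := hf.cont a x hx
    obtain ⟨a₂, h₂, l₂⟩ := hg.cont a y hy
    obtain ⟨a', h', k₁, k₂⟩ := hS.directed h₁ h₂
    exact ⟨a', h', (hR.le hb).trans
      (add_le_add (l₁.trans (hf.monotone k₁)) (l₂.trans (hg.monotone k₂)))⟩⟩

/-- The W-morphisms, as a monoid under pointwise addition (ordered pointwise). -/
def WMor (hS : IsPreW rS) (hR : IsPreW rR) : AddSubmonoid (S → R) where
  carrier := {f | IsWMor rS rR f}
  zero_mem' := ⟨(GenWMor hS hR).zero_mem, fun _ _ _ => hR.zero _⟩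
  add_mem' hf hg := ⟨(GenWMor hS hR).add_mem hf.toIsGenWMor hg.toIsGenWMor,
    fun a' a h => hR.w3 (hf.map_rel a' a h) (hg.map_rel a' a h)⟩

/-- The generalized W-bimorphisms, as a monoid under pointwise addition (ordered pointwise). -/
def GenWBimor (hS : IsPreW rS) (hT : IsPreW rT) (hR : IsPreW rR) : AddSubmonoid (S × T → R) where
  carrier := {f | IsGenWBimor rS rT rR f}
  zero_mem' := ⟨isPomBimor_zero, fun a b _ h => ⟨0, 0, hS.zero a, hT.zero b, hR.le h⟩⟩
  add_mem' {f g} hf hg := ⟨hf.toIsPomBimor.add hg.toIsPomBimor, fun a b r h => by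
    obtain ⟨x, y, hb, hx, hy⟩ := hR.w4 h
    obtain ⟨a₁, b₁, h₁, i₁, l₁⟩ := hf.cont a b x hx
    obtain ⟨a₂, b₂, h₂, i₂, l₂⟩ := hg.cont a b y hy
    obtain ⟨a', h', k₁, k₂⟩ := hS.directed h₁ h₂
    obtain ⟨b', i', m₁, m₂⟩ := hT.directed i₁ i₂
    exact ⟨a', b', h', i', (hR.le hb).trans (add_le_add
      (l₁.trans (((hf.left b₁).monotone k₁).trans ((hf.right a').monotone m₁)))
      (l₂.trans (((hg.left b₂).monotone k₂).trans ((hg.right a').monotone m₂))))⟩⟩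

/-- The W-bimorphisms, as a monoid under pointwise addition (ordered pointwise). -/
def WBimor (hS : IsPreW rS) (hT : IsPreW rT) (hR : IsPreW rR) : AddSubmonoid (S × T → R) where
  carrier := {f | IsWBimor rS rT rR f}
  zero_mem' := ⟨(GenWBimor hS hT hR).zero_mem, fun _ _ _ _ _ _ => hR.zero _⟩
  add_mem' hf hg := ⟨(GenWBimor hS hT hR).add_mem hf.toIsGenWBimor hg.toIsGenWBimor,
    fun a' a b' b h k => hR.w3 (hf.map_rel a' a b' b h k) (hg.map_rel a' a b' b h k)⟩

/-- Functoriality of W-morphism sets: composition with a W-morphism `h : R → R'`. -/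
def WMor.post {R' : Type w} [Pom R'] {rR' : R' → R' → Prop} (hS : IsPreW rS) {hR : IsPreW rR}
    {hR' : IsPreW rR'} (h : WMor hR hR') : WMor hS hR →+o WMor hS hR' where
  toFun g := ⟨h.1 ∘ g.1, ⟨⟨h.2.toIsPomMor.comp g.2.toIsPomMor, fun a c hc => by
    obtain ⟨r, hr, l⟩ := h.2.cont (g.1 a) c hc
    obtain ⟨a', ha, l'⟩ := g.2.cont a r hr
    exact ⟨a', ha, l.trans (h.2.monotone l')⟩⟩,
    fun a' a k => h.2.map_rel _ _ (g.2.map_rel a' a k)⟩⟩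
  map_zero' := Subtype.ext (funext fun _ => h.2.map_zero)
  map_add' _ _ := Subtype.ext (funext fun _ => h.2.map_add _ _)
  monotone' _ _ k a := h.2.monotone (k a)

/-- Functoriality of W-bimorphism sets: composition with a W-morphism `h : R → R'`. -/
def WBimor.post {R' : Type w} [Pom R'] {rR' : R' → R' → Prop} (hS : IsPreW rS) (hT : IsPreW rT)
    {hR : IsPreW rR} {hR' : IsPreW rR'} (h : WMor hR hR') :
    WBimor hS hT hR →+o WBimor hS hT hR' where
  toFun f := ⟨h.1 ∘ f.1, ⟨⟨⟨fun b => h.2.toIsPomMor.comp (f.2.left b),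
    fun a => h.2.toIsPomMor.comp (f.2.right a)⟩, fun a b c hc => by
    obtain ⟨r, hr, l⟩ := h.2.cont (f.1 (a, b)) c hc
    obtain ⟨a', b', ha, hb, l'⟩ := f.2.cont a b r hr
    exact ⟨a', b', ha, hb, l.trans (h.2.monotone l')⟩⟩,
    fun a' a b' b k k' => h.2.map_rel _ _ (f.2.map_rel a' a b' b k k')⟩⟩
  map_zero' := Subtype.ext (funext fun _ => h.2.map_zero)
  map_add' _ _ := Subtype.ext (funext fun _ => h.2.map_add _ _)
  monotone' _ _ k a := h.2.monotone (k a)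

end WMor

/-! ### The tensor product of PreW-semigroups -/

/-- The relation `≺` on `S ⊗ T` induced by auxiliary relations on `S` and `T`: `x ≺ y` if `y` has a
representative `∑ⱼ aⱼ ⊙ bⱼ` with nonzero `aⱼ, bⱼ` such that `x ≤ ∑_{j ∈ J'} aⱼ' ⊗ bⱼ'` for some
subset `J'` of the indices and nonzero `aⱼ' ≺ aⱼ`, `bⱼ' ≺ bⱼ` (`j ∈ J'`). -/
def TensorRel {S : Type u} {T : Type v} [Pom S] [Pom T] (rS : S → S → Prop) (rT : T → T → Prop)
    (x y : PomTensor S T) : Prop :=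
  ∃ (n : ℕ) (a : Fin n → S) (b : Fin n → T) (J : Finset (Fin n)) (a' : Fin n → S) (b' : Fin n → T),
    (∀ j, a j ≠ 0 ∧ b j ≠ 0) ∧
    (∀ j ∈ J, a' j ≠ 0 ∧ b' j ≠ 0 ∧ rS (a' j) (a j) ∧ rT (b' j) (b j)) ∧
    y = ∑ j, pomTensorMap S T (a j, b j) ∧
    x ≤ ∑ j ∈ J, pomTensorMap S T (a' j, b' j)

/-! ### Cu-semigroups, Cu-morphisms and Cu-bimorphisms -/

/-- Compact containment `a ≪ b` (sequential way-below relation). -/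
def CompactlyContained {S : Type u} [Pom S] (a b : S) : Prop :=
  ∀ (c : ℕ → S) (s : S), Monotone c → IsLUB (Set.range c) s → b ≤ s → ∃ k, a ≤ c k

/-- Cu-semigroups: positively ordered monoids with the axioms (O1)-(O4). -/
class IsCuSemigroup (S : Type u) [Pom S] : Prop where
  o1 : ∀ a : ℕ → S, Monotone a → ∃ s, IsLUB (Set.range a) s
  o2 : ∀ a : S, ∃ x : ℕ → S, (∀ k, CompactlyContained (x k) (x (k + 1))) ∧ IsLUB (Set.range x) a
  o3 : ∀ {a' a b' b : S}, CompactlyContained a' a → CompactlyContained b' b →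
    CompactlyContained (a' + b') (a + b)
  o4 : ∀ {a b : ℕ → S} {s t : S}, Monotone a → Monotone b → IsLUB (Set.range a) s →
    IsLUB (Set.range b) t → IsLUB (Set.range (a + b)) (s + t)

section CuMor

variable {S : Type u} {T : Type v} {R : Type w} [Pom S] [Pom T] [Pom R]

/-- A generalized Cu-morphism: a POM-morphism preserving suprema of increasing sequences. -/
structure IsGenCuMor (f : S → R) : Prop extends IsPomMor f where
  map_sup : ∀ (a : ℕ → S) (s : S), Monotone a → IsLUB (Set.range a) s →
    IsLUB (Set.range fun k => f (a k)) (f s)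

/-- A Cu-morphism: a generalized Cu-morphism preserving compact containment. -/
structure IsCuMor (f : S → R) : Prop extends IsGenCuMor f where
  map_rel : ∀ a' a, CompactlyContained a' a → CompactlyContained (f a') (f a)

/-- A generalized Cu-bimorphism: a POM-bimorphism with
`sup_k f (a_k, b_k) = f (sup_k a_k, sup_k b_k)` for all increasing sequences. -/
structure IsGenCuBimor (f : S × T → R) : Prop extends IsPomBimor f where
  map_sup : ∀ (a : ℕ → S) (b : ℕ → T) (s : S) (t : T), Monotone a → Monotone b →
    IsLUB (Set.range a) s → IsLUB (Set.range b) t →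
    IsLUB (Set.range fun k => f (a k, b k)) (f (s, t))

/-- A Cu-bimorphism: a generalized Cu-bimorphism jointly preserving compact containment. -/
structure IsCuBimor (f : S × T → R) : Prop extends IsGenCuBimor f where
  map_rel : ∀ a' a b' b, CompactlyContained a' a → CompactlyContained b' b →
    CompactlyContained (f (a', b')) (f (a, b))

theorem isLUB_range_zero : IsLUB (Set.range fun _ : ℕ => (0 : R)) 0 := by
  rw [Set.range_const]; exact isLUB_singleton

theorem compactlyContained_zero (b : R) : CompactlyContained 0 b :=
  fun c _ _ _ _ => ⟨0, Pom.nonneg (c 0)⟩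

variable (S T R) [IsCuSemigroup R]

/-- The generalized Cu-morphisms, as a monoid under pointwise addition (ordered pointwise). -/
def GenCuMor : AddSubmonoid (S → R) where
  carrier := {f | IsGenCuMor f}
  zero_mem' := ⟨isPomMor_zero, fun _ _ _ _ => isLUB_range_zero⟩
  add_mem' hf hg := ⟨hf.toIsPomMor.add hg.toIsPomMor, fun a s ha hs =>
    IsCuSemigroup.o4 (hf.monotone.comp ha) (hg.monotone.comp ha) (hf.map_sup a s ha hs)
      (hg.map_sup a s ha hs)⟩

/-- The Cu-morphisms, as a monoid under pointwise addition (ordered pointwise). -/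
def CuMor : AddSubmonoid (S → R) where
  carrier := {f | IsCuMor f}
  zero_mem' := ⟨(GenCuMor S R).zero_mem, fun _ _ _ => compactlyContained_zero _⟩
  add_mem' hf hg := ⟨(GenCuMor S R).add_mem hf.toIsGenCuMor hg.toIsGenCuMor,
    fun a' a h => IsCuSemigroup.o3 (hf.map_rel a' a h) (hg.map_rel a' a h)⟩

/-- The generalized Cu-bimorphisms, as a monoid under pointwise addition (ordered pointwise). -/
def GenCuBimor : AddSubmonoid (S × T → R) where
  carrier := {f | IsGenCuBimor f}
  zero_mem' := ⟨isPomBimor_zero, fun _ _ _ _ _ _ _ _ => isLUB_range_zero⟩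
  add_mem' hf hg := ⟨hf.toIsPomBimor.add hg.toIsPomBimor, fun a b s t ha hb hs ht =>
    IsCuSemigroup.o4 (hf.toIsPomBimor.monotone.comp (ha.prodMk hb))
      (hg.toIsPomBimor.monotone.comp (ha.prodMk hb))
      (hf.map_sup a b s t ha hb hs ht) (hg.map_sup a b s t ha hb hs ht)⟩

/-- The Cu-bimorphisms, as a monoid under pointwise addition (ordered pointwise). -/
def CuBimor : AddSubmonoid (S × T → R) where
  carrier := {f | IsCuBimor f}
  zero_mem' := ⟨(GenCuBimor S T R).zero_mem, fun _ _ _ _ _ _ => compactlyContained_zero _⟩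
  add_mem' hf hg := ⟨(GenCuBimor S T R).add_mem hf.toIsGenCuBimor hg.toIsGenCuBimor,
    fun a' a b' b h k => IsCuSemigroup.o3 (hf.map_rel a' a b' b h k) (hg.map_rel a' a b' b h k)⟩

variable {R}

/-- Functoriality of Cu-morphism sets: composition with a Cu-morphism `h : R → R'`. -/
def CuMor.post {R' : Type w} [Pom R'] [IsCuSemigroup R'] (h : CuMor R R') :
    CuMor S R →+o CuMor S R' where
  toFun g := ⟨h.1 ∘ g.1, ⟨⟨h.2.toIsPomMor.comp g.2.toIsPomMor, fun a s ha hs =>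
    h.2.map_sup _ _ (g.2.monotone.comp ha) (g.2.map_sup a s ha hs)⟩,
    fun a' a k => h.2.map_rel _ _ (g.2.map_rel a' a k)⟩⟩
  map_zero' := Subtype.ext (funext fun _ => h.2.map_zero)
  map_add' _ _ := Subtype.ext (funext fun _ => h.2.map_add _ _)
  monotone' _ _ k a := h.2.monotone (k a)

/-- Functoriality of Cu-bimorphism sets: composition with a Cu-morphism `h : R → R'`. -/
def CuBimor.post {R' : Type w} [Pom R'] [IsCuSemigroup R'] (h : CuMor R R') :
    CuBimor S T R →+o CuBimor S T R' where
  toFun f := ⟨h.1 ∘ f.1, ⟨⟨⟨fun b => h.2.toIsPomMor.comp (f.2.left b),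
    fun a => h.2.toIsPomMor.comp (f.2.right a)⟩, fun a b s t ha hb hs ht =>
    h.2.map_sup _ _ (f.2.toIsPomBimor.monotone.comp (ha.prodMk hb))
      (f.2.map_sup a b s t ha hb hs ht)⟩,
    fun a' a b' b k k' => h.2.map_rel _ _ (f.2.map_rel a' a b' b k k')⟩⟩
  map_zero' := Subtype.ext (funext fun _ => h.2.map_zero)
  map_add' _ _ := Subtype.ext (funext fun _ => h.2.map_add _ _)
  monotone' _ _ k a := h.2.monotone (k a)

end CuMor

/-! ### The Cu-completion of a PreW-semigroup -/

section Completion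

variable {S : Type u} [Pom S] {r : S → S → Prop}

/-- The `≺`-increasing sequences in a PreW-semigroup, with pointwise addition. -/
def relIncreasing (hr : IsPreW r) : AddSubmonoid (ℕ → S) where
  carrier := {a | ∀ k, r (a k) (a (k + 1))}
  zero_mem' _ := hr.zero _
  add_mem' ha hb k := hr.w3 (ha k) (hb k)

/-- The type of `≺`-increasing sequences in a PreW-semigroup. -/
def RelSeq (hr : IsPreW r) : Type u := relIncreasing hr

instance (hr : IsPreW r) : AddCommMonoid (RelSeq hr) :=
  inferInstanceAs (AddCommMonoid (relIncreasing hr))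

theorem RelSeq.mono {hr : IsPreW r} (a : RelSeq hr) : Monotone a.1 :=
  monotone_nat_of_le_succ fun k => hr.le (a.2 k)

/-- Sequences are pre-ordered by: for every `k` there is `n` with `a_k ≺ b_n`. -/
instance (hr : IsPreW r) : PrePom (RelSeq hr) where
  le a b := ∀ k, ∃ n, r (a.1 k) (b.1 n)
  le_refl a k := ⟨k + 1, a.2 k⟩
  le_trans a b c h h' k := by
    obtain ⟨n, hn⟩ := h k
    obtain ⟨m, hm⟩ := h' n
    exact ⟨m, hr.mono (hr.le hn) hm le_rfl⟩
  add_le_add_left a b h c k := by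
    obtain ⟨n, hn⟩ := h k
    exact ⟨max n (k + 1), hr.w3 (hr.mono le_rfl hn (b.mono (le_max_left ..)))
      (hr.mono le_rfl (c.2 k) (c.mono (le_max_right ..)))⟩
  nonneg a _ := ⟨0, hr.zero _⟩

/-- The Cu-completion `γ(S)`: the equivalence classes of `≺`-increasing sequences. -/
def CuCompletion (hr : IsPreW r) : Type u := PrePom.Reflection (RelSeq hr)

instance (hr : IsPreW r) : Pom (CuCompletion hr) :=
  inferInstanceAs (Pom (PrePom.Reflection (RelSeq hr)))

/-- The canonical map `α : S → γ(S)`, sending `a` to the class of a `≺`-increasing sequence that is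
cofinal among the `≺`-predecessors of `a`. -/
noncomputable def toCuCompletion (hr : IsPreW r) (a : S) : CuCompletion hr :=
  PrePom.toReflection (M := RelSeq hr)
    ⟨Classical.choose (hr.w1 a), (Classical.choose_spec (hr.w1 a)).2.1⟩

/-- `α : S → C` is a Cu-completion of the PreW-semigroup `(S, r)`: `C` is a Cu-semigroup, `α` is a
W-morphism to `(C, ≪)`, and every W-morphism from `S` to a Cu-semigroup factors uniquely through
`α` by a Cu-morphism. -/
def IsCuCompletion (r : S → S → Prop) {C : Type v} [Pom C] (α : S → C) : Prop :=
  IsCuSemigroup C ∧ IsWMor r CompactlyContained α ∧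
  ∀ (R : Type w) [Pom R] [IsCuSemigroup R] (f : S → R), IsWMor r CompactlyContained f →
    ∃! g : C → R, IsCuMor g ∧ f = g ∘ α

end Completion

/-- The map `φ = α ∘ ω : S × T → γ(S ⊗ T)`, where `S ⊗ T` carries the relation induced by `≪`. -/
noncomputable def cuTensorMap {S : Type u} {T : Type v} [Pom S] [Pom T]
    (h : IsPreW (TensorRel (CompactlyContained (S := S)) (CompactlyContained (S := T)))) :
    S × T → CuCompletion h :=
  toCuCompletion h ∘ pomTensorMap S T

/-!
The tensor product `S ⊗ T` of positively ordered monoids is the quotient of `ℕ[S × T]` by a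
generated pre-order, so POM-morphisms out of it are POM-bimorphisms out of `S × T`, and statements
about `S ⊗ T` are proved by additivity from elementary tensors.

What needs an argument is the relation `≺` on `S ⊗ T`. It is defined through some representative
`∑ⱼ aⱼ ⊙ bⱼ` of the larger element, and everything rests on the fact that any representative may be
used (`tensorRel_mk_iff`). To a formal sum `f = ∑ⱼ aⱼ ⊙ bⱼ` attach the set `FreeTensor.below f` of
all `∑ⱼ aⱼ' ⊗ bⱼ'` with `aⱼ' ≺ aⱼ` and `bⱼ' ≺ bⱼ`; this is additive in `f`. Each generating relation
`f ≤ g` has the property that every member of `below f` is dominated by a member of `below g`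
(`FreeTensor.Le.below_cofinal`), and the property is inherited by sums and composites. Two rules
follow: `x ≺ a ⊗ b` means `x ≤ a' ⊗ b'` with `a' ≺ a`, `b' ≺ b` (`tensorRel_tmul_iff`), and
`x ≺ y + z` implies `x ≤ y' + z'` with `y' ≺ y`, `z' ≺ z` (`TensorRel.exists_le_add`). The PreW
axioms and the universal property are then checked on elementary tensors and propagated to sums.

For the completion `γ(P)` of a PreW-semigroup, the class of `(bₙ)` is the supremum of the `α(bₙ)`
(`isLUB_toCuCompletion`), suprema of increasing sequences are built by choosing a cofinal sequence
in a countable `≺`-directed family (`CuCompletion.exists_isLUB`), and therefore `x ≪ [(bₙ)]` means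
`x ≤ α(bₙ)` for some `n` (`CuCompletion.compactlyContained_mk_iff`). This makes `γ(P)` a
Cu-semigroup, and a generalized W-morphism `f` into a Cu-semigroup extends by `[(bₙ)] ↦ sup f(bₙ)`.

Finally a Cu-semigroup with `≪` is a PreW-semigroup, for which generalized Cu-bimorphisms and
generalized W-bimorphisms coincide (`isGenCuBimor_iff`), so the two universal properties compose.
In both settings a generalized morphism `g` preserves the auxiliary relation exactly if `g ≺ g`;
since precomposition preserves and reflects `≺`, the statements on W- and Cu-morphisms follow from
those on generalized morphisms.
-/

/-! ### Finite sums of elementary tensors -/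

section PomTensorBasics

theorem Pom.eq_zero_of_le_zero {M : Type u} [Pom M] {a : M} (h : a ≤ 0) : a = 0 :=
  le_antisymm h (Pom.nonneg a)

/-- Every element of `ℕ[S × T]` is a finite sum of generators. -/
theorem FreeTensor.induction_on {S : Type u} {T : Type v} {p : FreeTensor S T → Prop}
    (f : FreeTensor S T) (zero : p 0) (of : ∀ a b, p (FreeTensor.of a b))
    (add : ∀ f g, p f → p g → p (f + g)) : p f := by
  refine Finsupp.induction_linear (motive := p) f zero add ?_
  rintro ⟨a, b⟩ n
  induction n with
  | zero => rw [Finsupp.single_zero]; exact zero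
  | succ n ih => rw [Finsupp.single_add]; exact add _ _ ih (of a b)

/-- The universal property of the free abelian monoid `ℕ[S × T]`. -/
noncomputable def FreeTensor.lift {S : Type u} {T : Type v} {M : Type w} [AddCommMonoid M]
    (f : S × T → M) : FreeTensor S T →+ M :=
  (Finsupp.liftAddHom fun p => multiplesHom M (f p) : (S × T →₀ ℕ) →+ M)

@[simp]
theorem FreeTensor.lift_of {S : Type u} {T : Type v} {M : Type w} [AddCommMonoid M]
    (f : S × T → M) (a : S) (b : T) :
    FreeTensor.lift f (FreeTensor.of a b) = f (a, b) :=
  (Finsupp.liftAddHom_apply_single _ _ _).trans (one_nsmul _)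

variable {S : Type u} {T : Type v} [Pom S] [Pom T]

/-- The quotient map `ℕ[S × T] → S ⊗ T`. -/
noncomputable def PomTensor.mk : FreeTensor S T →+ PomTensor S T where
  toFun := PrePom.toReflection
  map_zero' := rfl
  map_add' _ _ := rfl

@[simp]
theorem PomTensor.mk_of (a : S) (b : T) :
    PomTensor.mk (FreeTensor.of a b) = pomTensorMap S T (a, b) := rfl

theorem PomTensor.mk_surjective :
    Function.Surjective (PomTensor.mk : FreeTensor S T → PomTensor S T) := Quot.exists_rep

theorem PomTensor.mk_le_mk {f g : FreeTensor S T} :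
    PomTensor.mk f ≤ PomTensor.mk g ↔ FreeTensor.Le f g := Iff.rfl

theorem PomTensor.induction_on {p : PomTensor S T → Prop} (x : PomTensor S T) (zero : p 0)
    (tmul : ∀ a b, p (pomTensorMap S T (a, b))) (add : ∀ x y, p x → p y → p (x + y)) : p x := by
  obtain ⟨f, rfl⟩ := PomTensor.mk_surjective x
  induction f using FreeTensor.induction_on with
  | zero => rwa [map_zero]
  | of a b => exact tmul a b
  | add f g hf hg => rw [map_add]; exact add _ _ hf hg

theorem isPomBimor_pomTensorMap : IsPomBimor (pomTensorMap S T) where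
  left b :=
    { map_zero := le_antisymm (FreeTensor.Le.zero_left b) (FreeTensor.Le.nonneg _)
      map_add := fun a a' =>
        le_antisymm (FreeTensor.Le.split_left a a' b) (FreeTensor.Le.join_left a a' b)
      monotone := fun _ _ h => FreeTensor.Le.mono h le_rfl }
  right a :=
    { map_zero := le_antisymm (FreeTensor.Le.zero_right a) (FreeTensor.Le.nonneg _)
      map_add := fun b b' =>
        le_antisymm (FreeTensor.Le.split_right a b b') (FreeTensor.Le.join_right a b b')
      monotone := fun _ _ h => FreeTensor.Le.mono le_rfl h }

/-- The extension of a POM-bimorphism to `ℕ[S × T]` respects the generated pre-order. -/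
theorem IsPomBimor.lift_le_lift {R : Type w} [Pom R] {f : S × T → R} (hf : IsPomBimor f)
    {x y : FreeTensor S T} (h : FreeTensor.Le x y) :
    FreeTensor.lift f x ≤ FreeTensor.lift f y := by
  induction h with
  | refl => exact le_rfl
  | trans _ _ h k => exact h.trans k
  | add _ _ h k => rw [map_add, map_add]; exact add_le_add h k
  | nonneg => rw [map_zero]; exact Pom.nonneg _
  | zero_left b => simpa using (hf.left b).map_zero.le
  | zero_right a => simpa using (hf.right a).map_zero.le
  | split_left a a' b => simpa using ((hf.left b).map_add a a').le
  | join_left a a' b => simpa using ((hf.left b).map_add a a').ge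
  | split_right a b b' => simpa using ((hf.right a).map_add b b').le
  | join_right a b b' => simpa using ((hf.right a).map_add b b').ge
  | mono h k => simpa using hf.monotone (Prod.mk_le_mk.2 ⟨h, k⟩)

/-- The universal property of `S ⊗ T`: every POM-bimorphism factors through `ω`. -/
theorem IsPomBimor.exists_lift {R : Type w} [Pom R] {f : S × T → R} (hf : IsPomBimor f) :
    ∃ g : PomTensor S T → R, IsPomMor g ∧ f = g ∘ pomTensorMap S T := by
  have hl : ∀ x y : FreeTensor S T, (PrePom.symmCon (FreeTensor S T)).toSetoid x y →
      FreeTensor.lift f x = FreeTensor.lift f y := fun x y h =>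
    le_antisymm (hf.lift_le_lift h.1) (hf.lift_le_lift h.2)
  refine ⟨Quotient.lift (FreeTensor.lift f) hl, ⟨map_zero (FreeTensor.lift f), ?_, ?_⟩,
    funext fun p => (FreeTensor.lift_of f p.1 p.2).symm⟩
  · rintro ⟨x⟩ ⟨y⟩
    exact map_add (FreeTensor.lift f) x y
  · rintro ⟨x⟩ ⟨y⟩ h
    exact hf.lift_le_lift h

theorem IsPomMor.le_of_comp_pomTensorMap_le {R : Type w} [Pom R] {g₁ g₂ : PomTensor S T → R}
    (h₁ : IsPomMor g₁) (h₂ : IsPomMor g₂) (h : g₁ ∘ pomTensorMap S T ≤ g₂ ∘ pomTensorMap S T) :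
    g₁ ≤ g₂ := fun x => by
  induction x using PomTensor.induction_on with
  | zero => rw [h₁.map_zero, h₂.map_zero]
  | tmul a b => exact h (a, b)
  | add x y hx hy => rw [h₁.map_add, h₂.map_add]; exact add_le_add hx hy

end PomTensorBasics

/-! ### The auxiliary relation on the tensor product -/

section TensorRel

open scoped Pointwise

variable {S : Type u} {T : Type v} [Pom S] [Pom T] {rS : S → S → Prop} {rT : T → T → Prop}

theorem tensorRel_zero : TensorRel rS rT (0 : PomTensor S T) 0 :=
  ⟨0, Fin.elim0, Fin.elim0, ∅, Fin.elim0, Fin.elim0, fun j => j.elim0, fun j => j.elim0,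
    by simp, by simp⟩

theorem TensorRel.add {x x' y y' : PomTensor S T} (h : TensorRel rS rT x y)
    (h' : TensorRel rS rT x' y') : TensorRel rS rT (x + x') (y + y') := by
  obtain ⟨n, a, b, J, c, d, h₁, h₂, rfl, h₄⟩ := h
  obtain ⟨n', a', b', J', c', d', h₁', h₂', rfl, h₄'⟩ := h'
  refine ⟨n + n', Sum.elim a a' ∘ finSumFinEquiv.symm, Sum.elim b b' ∘ finSumFinEquiv.symm,
    (J.disjSum J').map finSumFinEquiv.toEmbedding, Sum.elim c c' ∘ finSumFinEquiv.symm,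
    Sum.elim d d' ∘ finSumFinEquiv.symm, ?_, ?_, ?_, ?_⟩
  · rw [finSumFinEquiv.symm.forall_congr_left]
    rintro (j | j)
    · simpa using h₁ j
    · simpa using h₁' j
  · simp only [Finset.mem_map_equiv]
    rw [finSumFinEquiv.symm.forall_congr_left]
    rintro (j | j)
    · simpa using h₂ j
    · simpa using h₂' j
  · rw [← finSumFinEquiv.sum_comp, Fintype.sum_sum_type]
    simp
  · rw [Finset.sum_map, Finset.sum_disjSum]
    simpa using add_le_add h₄ h₄'

theorem tensorRel_tmul {a a' : S} {b b' : T} (ha : rS a' a) (hb : rT b' b)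
    (hS : IsAuxiliary rS) (hT : IsAuxiliary rT) :
    TensorRel rS rT (pomTensorMap S T (a', b')) (pomTensorMap S T (a, b)) := by
  have zl : ∀ b : T, pomTensorMap S T (0, b) = 0 := fun b =>
    (isPomBimor_pomTensorMap.left b).map_zero
  have zr : ∀ a : S, pomTensorMap S T (a, 0) = 0 := fun a =>
    (isPomBimor_pomTensorMap.right a).map_zero
  by_cases h : a = 0 ∨ b = 0
  · -- Here `a'` or `b'` vanishes as well, and both elementary tensors are the empty sum.
    have e : pomTensorMap S T (a, b) = 0 := by
      rcases h with rfl | rfl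
      · exact zl b
      · exact zr a
    have e' : pomTensorMap S T (a', b') = 0 := by
      rcases h with rfl | rfl
      · rw [Pom.eq_zero_of_le_zero (hS.le ha), zl]
      · rw [Pom.eq_zero_of_le_zero (hT.le hb), zr]
    rw [e, e']
    exact tensorRel_zero
  · rw [not_or] at h
    by_cases h' : a' = 0 ∨ b' = 0
    · have e' : pomTensorMap S T (a', b') = 0 := by
        rcases h' with rfl | rfl
        · exact zl b'
        · exact zr a'
      exact ⟨1, fun _ => a, fun _ => b, ∅, fun _ => a', fun _ => b', fun _ => h,
        fun _ hj => absurd hj (Finset.notMem_empty _), by simp, by simp [e']⟩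
    · rw [not_or] at h'
      exact ⟨1, fun _ => a, fun _ => b, Finset.univ, fun _ => a', fun _ => b', fun _ => h,
        fun _ _ => ⟨h'.1, h'.2, ha, hb⟩, by simp, by simp⟩

theorem TensorRel.mono_left {x x' y : PomTensor S T} (h : x ≤ x') (h' : TensorRel rS rT x' y) :
    TensorRel rS rT x y := by
  obtain ⟨n, a, b, J, c, d, h₁, h₂, h₃, h₄⟩ := h'
  exact ⟨n, a, b, J, c, d, h₁, h₂, h₃, h.trans h₄⟩

/-- For a formal sum `f = ∑ⱼ aⱼ ⊙ bⱼ`, the set of all `∑ⱼ aⱼ' ⊗ bⱼ'` with `aⱼ' ≺ aⱼ` and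
`bⱼ' ≺ bⱼ`. It is additive in `f` with respect to pointwise addition of sets. -/
noncomputable def FreeTensor.below (rS : S → S → Prop) (rT : T → T → Prop) :
    FreeTensor S T →+ Set (PomTensor S T) :=
  FreeTensor.lift fun p => {x | ∃ a b, rS a p.1 ∧ rT b p.2 ∧ x = pomTensorMap S T (a, b)}

theorem FreeTensor.mem_below_of {a : S} {b : T} {x : PomTensor S T} :
    x ∈ FreeTensor.below rS rT (FreeTensor.of a b) ↔
      ∃ a' b', rS a' a ∧ rT b' b ∧ x = pomTensorMap S T (a', b') := by
  simp [FreeTensor.below]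

theorem FreeTensor.mem_below_zero {x : PomTensor S T} :
    x ∈ FreeTensor.below rS rT 0 ↔ x = 0 := by
  rw [map_zero, Set.mem_zero]

theorem FreeTensor.mem_below_add {f g : FreeTensor S T} {x : PomTensor S T} :
    x ∈ FreeTensor.below rS rT (f + g) ↔
      ∃ y ∈ FreeTensor.below rS rT f, ∃ z ∈ FreeTensor.below rS rT g, y + z = x := by
  rw [map_add, Set.mem_add]

/-- If `f ≤ g`, then the elements of `below f` are dominated by elements of `below g`. For the
additivity of `⊙` in one variable this is (W4) in that variable when a sum is split, and (W3) in
that variable together with directedness of `≺` in the other one when two terms are joined. -/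
theorem FreeTensor.Le.below_cofinal (hS : IsPreW rS) (hT : IsPreW rT) {f g : FreeTensor S T}
    (h : FreeTensor.Le f g) {x : PomTensor S T} (hx : x ∈ FreeTensor.below rS rT f) :
    ∃ y ∈ FreeTensor.below rS rT g, x ≤ y := by
  have hω := isPomBimor_pomTensorMap (S := S) (T := T)
  have zero_mem : ∀ f : FreeTensor S T, 0 ∈ FreeTensor.below rS rT f := fun f => by
    induction f using FreeTensor.induction_on with
    | zero => exact FreeTensor.mem_below_zero.2 rfl
    | of a b =>
      exact FreeTensor.mem_below_of.2 ⟨0, 0, hS.zero a, hT.zero b, (hω.left 0).map_zero.symm⟩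
    | add f g hf hg => exact FreeTensor.mem_below_add.2 ⟨0, hf, 0, hg, add_zero 0⟩
  induction h generalizing x with
  | refl => exact ⟨x, hx, le_rfl⟩
  | trans _ _ h k =>
    obtain ⟨y, hy, l⟩ := h hx
    obtain ⟨z, hz, l'⟩ := k hy
    exact ⟨z, hz, l.trans l'⟩
  | add _ _ h k =>
    obtain ⟨y, hy, z, hz, rfl⟩ := FreeTensor.mem_below_add.1 hx
    obtain ⟨y', hy', l⟩ := h hy
    obtain ⟨z', hz', l'⟩ := k hz
    exact ⟨_, FreeTensor.mem_below_add.2 ⟨y', hy', z', hz', rfl⟩, add_le_add l l'⟩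
  | nonneg f => exact ⟨0, zero_mem f, (FreeTensor.mem_below_zero.1 hx).le⟩
  | zero_left b =>
    obtain ⟨a', b', ha, -, rfl⟩ := FreeTensor.mem_below_of.1 hx
    refine ⟨0, zero_mem 0, ?_⟩
    rw [Pom.eq_zero_of_le_zero (hS.le ha), (hω.left b').map_zero]
  | zero_right a =>
    obtain ⟨a', b', -, hb, rfl⟩ := FreeTensor.mem_below_of.1 hx
    refine ⟨0, zero_mem 0, ?_⟩
    rw [Pom.eq_zero_of_le_zero (hT.le hb), (hω.right a').map_zero]
  | split_left a₁ a₂ b =>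
    obtain ⟨a', b', ha, hb, rfl⟩ := FreeTensor.mem_below_of.1 hx
    obtain ⟨c₁, c₂, hc, h₁, h₂⟩ := hS.w4 ha
    exact ⟨_, FreeTensor.mem_below_add.2 ⟨_, FreeTensor.mem_below_of.2 ⟨c₁, b', h₁, hb, rfl⟩,
      _, FreeTensor.mem_below_of.2 ⟨c₂, b', h₂, hb, rfl⟩, rfl⟩,
      ((hω.left b').monotone (hS.le hc)).trans_eq ((hω.left b').map_add c₁ c₂)⟩
  | join_left a₁ a₂ b =>
    obtain ⟨y, hy, z, hz, rfl⟩ := FreeTensor.mem_below_add.1 hx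
    obtain ⟨c₁, b₁, hc₁, hb₁, rfl⟩ := FreeTensor.mem_below_of.1 hy
    obtain ⟨c₂, b₂, hc₂, hb₂, rfl⟩ := FreeTensor.mem_below_of.1 hz
    obtain ⟨b', hb, k₁, k₂⟩ := hT.directed hb₁ hb₂
    exact ⟨_, FreeTensor.mem_below_of.2 ⟨_, b', hS.w3 hc₁ hc₂, hb, rfl⟩,
      (add_le_add ((hω.right c₁).monotone k₁) ((hω.right c₂).monotone k₂)).trans_eq
        ((hω.left b').map_add c₁ c₂).symm⟩
  | split_right a b₁ b₂ =>
    obtain ⟨a', b', ha, hb, rfl⟩ := FreeTensor.mem_below_of.1 hx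
    obtain ⟨c₁, c₂, hc, h₁, h₂⟩ := hT.w4 hb
    exact ⟨_, FreeTensor.mem_below_add.2 ⟨_, FreeTensor.mem_below_of.2 ⟨a', c₁, ha, h₁, rfl⟩,
      _, FreeTensor.mem_below_of.2 ⟨a', c₂, ha, h₂, rfl⟩, rfl⟩,
      ((hω.right a').monotone (hT.le hc)).trans_eq ((hω.right a').map_add c₁ c₂)⟩
  | join_right a b₁ b₂ =>
    obtain ⟨y, hy, z, hz, rfl⟩ := FreeTensor.mem_below_add.1 hx
    obtain ⟨a₁, c₁, ha₁, hc₁, rfl⟩ := FreeTensor.mem_below_of.1 hy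
    obtain ⟨a₂, c₂, ha₂, hc₂, rfl⟩ := FreeTensor.mem_below_of.1 hz
    obtain ⟨a', ha, k₁, k₂⟩ := hS.directed ha₁ ha₂
    exact ⟨_, FreeTensor.mem_below_of.2 ⟨a', _, ha, hT.w3 hc₁ hc₂, rfl⟩,
      (add_le_add ((hω.left c₁).monotone k₁) ((hω.left c₂).monotone k₂)).trans_eq
        ((hω.right a').map_add c₁ c₂).symm⟩
  | mono h k =>
    obtain ⟨a', b', ha, hb, rfl⟩ := FreeTensor.mem_below_of.1 hx
    exact ⟨_, FreeTensor.mem_below_of.2 ⟨a', b', hS.mono le_rfl ha h, hT.mono le_rfl hb k, rfl⟩,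
      le_rfl⟩

/-- The relation `x ≺ y` can be tested on any representative of `y`. -/
theorem tensorRel_mk_iff (hS : IsPreW rS) (hT : IsPreW rT) {x : PomTensor S T}
    {f : FreeTensor S T} :
    TensorRel rS rT x (PomTensor.mk f) ↔ ∃ y ∈ FreeTensor.below rS rT f, x ≤ y := by
  classical
  constructor
  · rintro ⟨n, a, b, J, a', b', -, hJ, hf, hx⟩
    have hle : FreeTensor.Le (∑ j, FreeTensor.of (a j) (b j)) f := by
      rw [← PomTensor.mk_le_mk, hf, map_sum]
      exact le_rfl
    -- Outside `J`, the term `aⱼ ⊙ bⱼ` contributes `0 ⊗ 0 = 0`, where `0 ≺ aⱼ` and `0 ≺ bⱼ`.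
    have hmem : ∑ j ∈ J, pomTensorMap S T (a' j, b' j) ∈
        FreeTensor.below rS rT (∑ j, FreeTensor.of (a j) (b j)) := by
      rw [map_sum, ← Finset.univ_inter J, ← Finset.sum_ite_mem]
      refine Set.finsetSum_mem_finsetSum _ _ _ fun j _ => ?_
      split_ifs with hj
      · exact FreeTensor.mem_below_of.2 ⟨_, _, (hJ j hj).2.2.1, (hJ j hj).2.2.2, rfl⟩
      · exact FreeTensor.mem_below_of.2 ⟨0, 0, hS.zero _, hT.zero _,
          (isPomBimor_pomTensorMap.left 0).map_zero.symm⟩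
    obtain ⟨y, hy, l⟩ := hle.below_cofinal hS hT hmem
    exact ⟨y, hy, hx.trans l⟩
  · rintro ⟨y, hy, hx⟩
    refine TensorRel.mono_left hx ?_
    clear hx
    induction f using FreeTensor.induction_on generalizing y with
    | zero =>
      rw [FreeTensor.mem_below_zero.1 hy, map_zero]
      exact tensorRel_zero
    | of a b =>
      obtain ⟨a', b', ha, hb, rfl⟩ := FreeTensor.mem_below_of.1 hy
      exact tensorRel_tmul ha hb hS.toIsAuxiliary hT.toIsAuxiliary
    | add f g hf hg =>
      obtain ⟨y₁, h₁, y₂, h₂, rfl⟩ := FreeTensor.mem_below_add.1 hy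
      rw [map_add]
      exact (hf y₁ h₁).add (hg y₂ h₂)

theorem tensorRel_tmul_iff (hS : IsPreW rS) (hT : IsPreW rT) {x : PomTensor S T} {a : S} {b : T} :
    TensorRel rS rT x (pomTensorMap S T (a, b)) ↔
      ∃ a' b', rS a' a ∧ rT b' b ∧ x ≤ pomTensorMap S T (a', b') := by
  rw [← PomTensor.mk_of, tensorRel_mk_iff hS hT]
  constructor
  · rintro ⟨y, hy, l⟩
    obtain ⟨a', b', ha, hb, rfl⟩ := FreeTensor.mem_below_of.1 hy
    exact ⟨a', b', ha, hb, l⟩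
  · rintro ⟨a', b', ha, hb, l⟩
    exact ⟨_, FreeTensor.mem_below_of.2 ⟨a', b', ha, hb, rfl⟩, l⟩

theorem TensorRel.exists_le_add (hS : IsPreW rS) (hT : IsPreW rT) {x y z : PomTensor S T}
    (h : TensorRel rS rT x (y + z)) :
    ∃ y' z', x ≤ y' + z' ∧ TensorRel rS rT y' y ∧ TensorRel rS rT z' z := by
  obtain ⟨f, rfl⟩ := PomTensor.mk_surjective y
  obtain ⟨g, rfl⟩ := PomTensor.mk_surjective z
  rw [← map_add, tensorRel_mk_iff hS hT] at h
  obtain ⟨w, hw, l⟩ := h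
  obtain ⟨y', hy, z', hz, rfl⟩ := FreeTensor.mem_below_add.1 hw
  exact ⟨y', z', l, (tensorRel_mk_iff hS hT).2 ⟨y', hy, le_rfl⟩,
    (tensorRel_mk_iff hS hT).2 ⟨z', hz, le_rfl⟩⟩

theorem TensorRel.eq_zero (hS : IsPreW rS) (hT : IsPreW rT) {x : PomTensor S T}
    (h : TensorRel rS rT x 0) : x = 0 := by
  rw [← map_zero PomTensor.mk, tensorRel_mk_iff hS hT] at h
  obtain ⟨y, hy, l⟩ := h
  exact Pom.eq_zero_of_le_zero (l.trans_eq (FreeTensor.mem_below_zero.1 hy))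

theorem isAuxiliary_tensorRel (hS : IsPreW rS) (hT : IsPreW rT) :
    IsAuxiliary (TensorRel rS rT) where
  le {x y} h := by
    induction y using PomTensor.induction_on generalizing x with
    | zero => exact (h.eq_zero hS hT).le
    | tmul a b =>
      obtain ⟨a', b', ha, hb, l⟩ := (tensorRel_tmul_iff hS hT).1 h
      exact l.trans (isPomBimor_pomTensorMap.monotone (Prod.mk_le_mk.2 ⟨hS.le ha, hT.le hb⟩))
    | add y z hy hz =>
      obtain ⟨y', z', l, h₁, h₂⟩ := h.exists_le_add hS hT
      exact l.trans (add_le_add (hy h₁) (hz h₂))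
  mono {x x' y y'} h h' k := by
    obtain ⟨f, rfl⟩ := PomTensor.mk_surjective y
    obtain ⟨g, rfl⟩ := PomTensor.mk_surjective y'
    obtain ⟨z, hz, l⟩ := (tensorRel_mk_iff hS hT).1 h'
    obtain ⟨z', hz', l'⟩ := (PomTensor.mk_le_mk.1 k).below_cofinal hS hT hz
    exact (tensorRel_mk_iff hS hT).2 ⟨z', hz', (h.trans l).trans l'⟩
  zero y := by
    induction y using PomTensor.induction_on with
    | zero => exact tensorRel_zero
    | tmul a b => exact (tensorRel_tmul_iff hS hT).2 ⟨0, 0, hS.zero a, hT.zero b, Pom.nonneg _⟩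
    | add y z hy hz => simpa using hy.add hz

theorem exists_seq_tensorRel (hS : IsPreW rS) (hT : IsPreW rT) (y : PomTensor S T) :
    ∃ x : ℕ → PomTensor S T, (∀ k, TensorRel rS rT (x k) y) ∧
      (∀ k, TensorRel rS rT (x k) (x (k + 1))) ∧
      ∀ z, TensorRel rS rT z y → ∃ k, TensorRel rS rT z (x k) := by
  have hA := isAuxiliary_tensorRel hS hT
  induction y using PomTensor.induction_on with
  | zero => exact ⟨fun _ => 0, fun _ => tensorRel_zero, fun _ => tensorRel_zero, fun _ h => ⟨0, h⟩⟩
  | tmul a b =>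
    obtain ⟨s, hs, hs', cs⟩ := hS.w1 a
    obtain ⟨t, ht, ht', ct⟩ := hT.w1 b
    refine ⟨fun k => pomTensorMap S T (s k, t k),
      fun k => tensorRel_tmul (hs k) (ht k) hS.toIsAuxiliary hT.toIsAuxiliary,
      fun k => tensorRel_tmul (hs' k) (ht' k) hS.toIsAuxiliary hT.toIsAuxiliary, fun z hz => ?_⟩
    obtain ⟨a', b', ha, hb, l⟩ := (tensorRel_tmul_iff hS hT).1 hz
    obtain ⟨i, hi⟩ := cs a' ha
    obtain ⟨j, hj⟩ := ct b' hb
    have ms : Monotone s := monotone_nat_of_le_succ fun k => hS.le (hs' k)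
    have mt : Monotone t := monotone_nat_of_le_succ fun k => hT.le (ht' k)
    exact ⟨max i j, (tensorRel_tmul_iff hS hT).2 ⟨a', b',
      hS.mono le_rfl hi (ms (le_max_left ..)), hT.mono le_rfl hj (mt (le_max_right ..)), l⟩⟩
  | add y z hy hz =>
    obtain ⟨s, hs, hs', cs⟩ := hy
    obtain ⟨t, ht, ht', ct⟩ := hz
    refine ⟨s + t, fun k => (hs k).add (ht k), fun k => (hs' k).add (ht' k), fun w hw => ?_⟩
    obtain ⟨y', z', l, h₁, h₂⟩ := hw.exists_le_add hS hT
    obtain ⟨i, hi⟩ := cs y' h₁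
    obtain ⟨j, hj⟩ := ct z' h₂
    have ms : Monotone s := monotone_nat_of_le_succ fun k => hA.le (hs' k)
    have mt : Monotone t := monotone_nat_of_le_succ fun k => hA.le (ht' k)
    exact ⟨max i j, TensorRel.mono_left l ((hA.mono le_rfl hi (ms (le_max_left ..))).add
      (hA.mono le_rfl hj (mt (le_max_right ..))))⟩

theorem isPreW_tensorRel (hS : IsPreW rS) (hT : IsPreW rT) : IsPreW (TensorRel rS rT) where
  toIsAuxiliary := isAuxiliary_tensorRel hS hT
  w1 := exists_seq_tensorRel hS hT
  w3 := TensorRel.add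
  w4 {x y z} h := by
    obtain ⟨y', z', l, h₁, h₂⟩ := h.exists_le_add hS hT
    obtain ⟨s, hs, -, cs⟩ := exists_seq_tensorRel hS hT y
    obtain ⟨t, ht, -, ct⟩ := exists_seq_tensorRel hS hT z
    obtain ⟨i, hi⟩ := cs y' h₁
    obtain ⟨j, hj⟩ := ct z' h₂
    exact ⟨s i, t j, TensorRel.mono_left l (hi.add hj), hs i, ht j⟩

theorem isWBimor_pomTensorMap (hS : IsPreW rS) (hT : IsPreW rT) :
    IsWBimor rS rT (TensorRel rS rT) (pomTensorMap S T) where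
  toIsPomBimor := isPomBimor_pomTensorMap
  cont _ _ _ h := (tensorRel_tmul_iff hS hT).1 h
  map_rel _ _ _ _ ha hb := tensorRel_tmul ha hb hS.toIsAuxiliary hT.toIsAuxiliary

/-! ### The universal property of the tensor product of PreW-semigroups -/

variable {R : Type w} [Pom R] {rR : R → R → Prop}

/-- Continuity extends from elementary tensors to sums by (W4) in the codomain. -/
theorem IsGenWBimor.exists_lift (hS : IsPreW rS) (hT : IsPreW rT) (hR : IsPreW rR)
    {f : S × T → R} (hf : IsGenWBimor rS rT rR f) :
    ∃ g : PomTensor S T → R, IsGenWMor (TensorRel rS rT) rR g ∧ f = g ∘ pomTensorMap S T := by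
  obtain ⟨g, hg, rfl⟩ := hf.toIsPomBimor.exists_lift
  refine ⟨g, ⟨hg, fun x r h => ?_⟩, rfl⟩
  induction x using PomTensor.induction_on generalizing r with
  | zero => exact ⟨0, tensorRel_zero, hR.le h⟩
  | tmul a b =>
    obtain ⟨a', b', ha, hb, l⟩ := hf.cont a b r h
    exact ⟨_, tensorRel_tmul ha hb hS.toIsAuxiliary hT.toIsAuxiliary, l⟩
  | add x y hx hy =>
    rw [hg.map_add] at h
    obtain ⟨c, d, hcd, hc, hd⟩ := hR.w4 h
    obtain ⟨x', hx', l⟩ := hx c hc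
    obtain ⟨y', hy', l'⟩ := hy d hd
    exact ⟨x' + y', hx'.add hy',
      (hR.le hcd).trans ((add_le_add l l').trans_eq (hg.map_add x' y').symm)⟩

theorem bimorRel_comp_pomTensorMap_iff (hS : IsPreW rS) (hT : IsPreW rT) (hR : IsPreW rR)
    {g₁ g₂ : PomTensor S T → R} (h₁ : IsPomMor g₁) (h₂ : IsPomMor g₂) :
    BimorRel rS rT rR (g₁ ∘ pomTensorMap S T) (g₂ ∘ pomTensorMap S T) ↔
      MorRel (TensorRel rS rT) rR g₁ g₂ := by
  refine ⟨fun h x y k => ?_, fun h a' a b' b ha hb =>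
    h _ _ (tensorRel_tmul ha hb hS.toIsAuxiliary hT.toIsAuxiliary)⟩
  induction y using PomTensor.induction_on generalizing x with
  | zero => rw [k.eq_zero hS hT, h₁.map_zero, h₂.map_zero]; exact hR.zero 0
  | tmul a b =>
    obtain ⟨a', b', ha, hb, l⟩ := (tensorRel_tmul_iff hS hT).1 k
    exact hR.mono (h₁.monotone l) (h a' a b' b ha hb) le_rfl
  | add y z hy hz =>
    obtain ⟨y', z', l, k₁, k₂⟩ := k.exists_le_add hS hT
    exact hR.mono ((h₁.monotone l).trans_eq (h₁.map_add y' z')) (hR.w3 (hy y' k₁) (hz z' k₂))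
      (h₂.map_add y z).ge

theorem IsWBimor.exists_lift (hS : IsPreW rS) (hT : IsPreW rT) (hR : IsPreW rR)
    {f : S × T → R} (hf : IsWBimor rS rT rR f) :
    ∃ g : PomTensor S T → R, IsWMor (TensorRel rS rT) rR g ∧ f = g ∘ pomTensorMap S T := by
  obtain ⟨g, hg, rfl⟩ := hf.toIsGenWBimor.exists_lift hS hT hR
  exact ⟨g, ⟨hg, (bimorRel_comp_pomTensorMap_iff hS hT hR hg.toIsPomMor hg.toIsPomMor).1
    hf.map_rel⟩, rfl⟩

end TensorRel

section Composition

variable {S : Type u} {T : Type v} [Pom S] [Pom T] {rS : S → S → Prop} {rT : T → T → Prop}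
  {R R' : Type*} [Pom R] [Pom R'] {rR : R → R → Prop} {rR' : R' → R' → Prop}

theorem IsPomMor.comp_bimor {g : R → R'} (hg : IsPomMor g) {f : S × T → R} (hf : IsPomBimor f) :
    IsPomBimor (g ∘ f) := ⟨fun b =>
      ⟨by simp [(hf.left b).map_zero, hg.map_zero], fun a a' => by
        simp [(hf.left b).map_add, hg.map_add], hg.monotone.comp (hf.left b).monotone⟩, fun a =>
      ⟨by simp [(hf.right a).map_zero, hg.map_zero], fun b b' => by
        simp [(hf.right a).map_add, hg.map_add], hg.monotone.comp (hf.right a).monotone⟩⟩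

theorem IsGenWMor.comp_bimor {g : R → R'} (hg : IsGenWMor rR rR' g) {f : S × T → R}
    (hf : IsGenWBimor rS rT rR f) : IsGenWBimor rS rT rR' (g ∘ f) :=
  ⟨hg.toIsPomMor.comp_bimor hf.toIsPomBimor, fun a b c hc => by
    obtain ⟨r, hr, l⟩ := hg.cont (f (a, b)) c hc
    obtain ⟨a', b', ha, hb, l'⟩ := hf.cont a b r hr
    exact ⟨a', b', ha, hb, l.trans (hg.monotone l')⟩⟩

theorem IsWMor.comp_bimor {g : R → R'} (hg : IsWMor rR rR' g) {f : S × T → R}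
    (hf : IsWBimor rS rT rR f) : IsWBimor rS rT rR' (g ∘ f) :=
  ⟨hg.toIsGenWMor.comp_bimor hf.toIsGenWBimor,
    fun a' a b' b k k' => hg.map_rel _ _ (hf.map_rel a' a b' b k k')⟩

end Composition

/-! ### Cu-semigroups as PreW-semigroups -/

section CuAsPreW

theorem CompactlyContained.le {R : Type u} [Pom R] {a b : R} (h : CompactlyContained a b) :
    a ≤ b := by
  obtain ⟨_, h⟩ := h (fun _ => b) b monotone_const
    (by rw [Set.range_const]; exact isLUB_singleton) le_rfl
  exact h

theorem isAuxiliary_compactlyContained {R : Type u} [Pom R] :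
    IsAuxiliary (CompactlyContained (S := R)) where
  le := CompactlyContained.le
  mono h k l c s hc hs hd := by
    obtain ⟨n, hn⟩ := k c s hc hs (l.trans hd)
    exact ⟨n, h.trans hn⟩
  zero := compactlyContained_zero

/-- A Cu-semigroup is a PreW-semigroup for `≪`. -/
theorem isPreW_compactlyContained (R : Type u) [Pom R] [IsCuSemigroup R] :
    IsPreW (CompactlyContained (S := R)) where
  toIsAuxiliary := isAuxiliary_compactlyContained
  w1 a := by
    have hA := isAuxiliary_compactlyContained (R := R)
    obtain ⟨x, hx, hs⟩ := IsCuSemigroup.o2 a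
    have hm : Monotone x := monotone_nat_of_le_succ fun k => (hx k).le
    refine ⟨x, fun k => hA.mono le_rfl (hx k) (hs.1 ⟨k + 1, rfl⟩), hx, fun b hb => ?_⟩
    obtain ⟨k, hk⟩ := hb x a hm hs le_rfl
    exact ⟨k + 1, hA.mono hk (hx k) le_rfl⟩
  w3 := IsCuSemigroup.o3
  w4 {a b c} h := by
    have hA := isAuxiliary_compactlyContained (R := R)
    obtain ⟨x, hx, hb⟩ := IsCuSemigroup.o2 b
    obtain ⟨y, hy, hc⟩ := IsCuSemigroup.o2 c
    have mx : Monotone x := monotone_nat_of_le_succ fun k => (hx k).le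
    have my : Monotone y := monotone_nat_of_le_succ fun k => (hy k).le
    obtain ⟨k, hk⟩ := h (x + y) (b + c) (mx.add my) (IsCuSemigroup.o4 mx my hb hc) le_rfl
    exact ⟨x (k + 1), y (k + 1), hA.mono hk (IsCuSemigroup.o3 (hx k) (hy k)) le_rfl,
      hA.mono le_rfl (hx _) (hb.1 ⟨_, rfl⟩), hA.mono le_rfl (hy _) (hc.1 ⟨_, rfl⟩)⟩

/-- In a Cu-semigroup, an element is determined by the elements compactly contained in it. -/
theorem le_of_forall_compactlyContained_le {R : Type u} [Pom R] [IsCuSemigroup R] {a b : R}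
    (h : ∀ c, CompactlyContained c a → c ≤ b) : a ≤ b := by
  obtain ⟨x, hx, hs⟩ := IsCuSemigroup.o2 a
  refine hs.2 ?_
  rintro _ ⟨k, rfl⟩
  exact h _ (isAuxiliary_compactlyContained.mono le_rfl (hx k) (hs.1 ⟨k + 1, rfl⟩))

variable {S : Type u} {T : Type v} {R : Type w} [Pom S] [Pom T] [Pom R]

theorem IsGenCuMor.comp_bimor {R' : Type*} [Pom R'] {g : R → R'} (hg : IsGenCuMor g)
    {f : S × T → R} (hf : IsGenCuBimor f) : IsGenCuBimor (g ∘ f) :=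
  ⟨hg.toIsPomMor.comp_bimor hf.toIsPomBimor, fun a b s t ha hb hs ht =>
    hg.map_sup _ _ (hf.toIsPomBimor.monotone.comp (ha.prodMk hb)) (hf.map_sup a b s t ha hb hs ht)⟩

variable [IsCuSemigroup S] [IsCuSemigroup T] [IsCuSemigroup R]

/-- Between Cu-semigroups, preservation of suprema is the same as continuity for `≪`. -/
theorem isGenCuBimor_iff {f : S × T → R} :
    IsGenCuBimor f ↔ IsGenWBimor CompactlyContained CompactlyContained CompactlyContained f := by
  refine ⟨fun h => ⟨h.toIsPomBimor, fun a b r hr => ?_⟩,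
    fun h => ⟨h.toIsPomBimor, fun x y a b hx hy ha hb => ⟨?_, fun u hu => ?_⟩⟩⟩
  · obtain ⟨x, hx, ha⟩ := IsCuSemigroup.o2 a
    obtain ⟨y, hy, hb⟩ := IsCuSemigroup.o2 b
    have mx : Monotone x := monotone_nat_of_le_succ fun k => (hx k).le
    have my : Monotone y := monotone_nat_of_le_succ fun k => (hy k).le
    obtain ⟨k, hk⟩ := hr _ _ (h.toIsPomBimor.monotone.comp (mx.prodMk my))
      (h.map_sup x y a b mx my ha hb) le_rfl
    exact ⟨x k, y k, isAuxiliary_compactlyContained.mono le_rfl (hx k) (ha.1 ⟨_, rfl⟩),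
      isAuxiliary_compactlyContained.mono le_rfl (hy k) (hb.1 ⟨_, rfl⟩), hk⟩
  · rintro _ ⟨k, rfl⟩
    exact h.toIsPomBimor.monotone (Prod.mk_le_mk.2 ⟨ha.1 ⟨k, rfl⟩, hb.1 ⟨k, rfl⟩⟩)
  · refine le_of_forall_compactlyContained_le fun r hr => ?_
    obtain ⟨a', b', ha', hb', l⟩ := h.cont a b r hr
    obtain ⟨i, hi⟩ := ha' x a hx ha le_rfl
    obtain ⟨j, hj⟩ := hb' y b hy hb le_rfl
    refine l.trans ((h.toIsPomBimor.monotone (Prod.mk_le_mk.2 ⟨hi.trans (hx (le_max_left i j)),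
      hj.trans (hy (le_max_right i j))⟩)).trans (hu ⟨max i j, rfl⟩))

end CuAsPreW

/-! ### The order structure of the Cu-completion -/

section Completion

variable {S : Type u} [Pom S] {r : S → S → Prop} {hr : IsPreW r}

/-- The class in `γ(S)` of a `≺`-increasing sequence. -/
def CuCompletion.mk : RelSeq hr →+ CuCompletion hr where
  toFun := PrePom.toReflection
  map_zero' := rfl
  map_add' _ _ := rfl

theorem CuCompletion.mk_surjective :
    Function.Surjective (CuCompletion.mk : RelSeq hr → CuCompletion hr) := Quot.exists_rep

theorem CuCompletion.mk_le_mk {a b : RelSeq hr} :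
    CuCompletion.mk a ≤ CuCompletion.mk b ↔ ∀ k, ∃ n, r (a.1 k) (b.1 n) := Iff.rfl

variable (hr) in
theorem exists_toCuCompletion_eq_mk (s : S) :
    ∃ a : RelSeq hr, toCuCompletion hr s = CuCompletion.mk a ∧ (∀ k, r (a.1 k) s) ∧
      ∀ b, r b s → ∃ k, r b (a.1 k) :=
  ⟨_, rfl, (Classical.choose_spec (hr.w1 s)).1, (Classical.choose_spec (hr.w1 s)).2.2⟩

theorem toCuCompletion_le_mk {s : S} {b : RelSeq hr} :
    toCuCompletion hr s ≤ CuCompletion.mk b ↔ ∀ t, r t s → ∃ n, r t (b.1 n) := by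
  obtain ⟨a, e, h, hc⟩ := exists_toCuCompletion_eq_mk hr s
  rw [e, CuCompletion.mk_le_mk]
  refine ⟨fun l t ht => ?_, fun l k => l _ (h k)⟩
  obtain ⟨k, hk⟩ := hc t ht
  obtain ⟨n, hn⟩ := l k
  exact ⟨n, hr.mono (hr.le hk) hn le_rfl⟩

theorem mk_le_toCuCompletion {s : S} {a : RelSeq hr} :
    CuCompletion.mk a ≤ toCuCompletion hr s ↔ ∀ k, r (a.1 k) s := by
  obtain ⟨b, e, h, hc⟩ := exists_toCuCompletion_eq_mk hr s
  rw [e, CuCompletion.mk_le_mk]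
  refine ⟨fun l k => ?_, fun l k => hc _ (l k)⟩
  obtain ⟨n, hn⟩ := l k
  exact hr.mono (hr.le hn) (h n) le_rfl

theorem isPomMor_toCuCompletion : IsPomMor (toCuCompletion hr) where
  map_zero := by
    refine le_antisymm ?_ (Pom.nonneg _)
    rw [← map_zero CuCompletion.mk, toCuCompletion_le_mk]
    exact fun t ht => ⟨0, ht⟩
  map_add s t := by
    obtain ⟨a, ea, ha, ca⟩ := exists_toCuCompletion_eq_mk hr s
    obtain ⟨b, eb, hb, cb⟩ := exists_toCuCompletion_eq_mk hr t
    rw [ea, eb, ← map_add]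
    refine le_antisymm (toCuCompletion_le_mk.2 fun u hu => ?_)
      (mk_le_toCuCompletion.2 fun k => hr.w3 (ha k) (hb k))
    obtain ⟨s', t', l, hs, ht⟩ := hr.w4 hu
    obtain ⟨i, hi⟩ := ca s' hs
    obtain ⟨j, hj⟩ := cb t' ht
    exact ⟨max i j, hr.mono (hr.le l) (hr.w3 (hr.mono le_rfl hi (a.mono (le_max_left ..)))
      (hr.mono le_rfl hj (b.mono (le_max_right ..)))) le_rfl⟩
  monotone s t h := by
    obtain ⟨b, e, -, hc⟩ := exists_toCuCompletion_eq_mk hr t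
    rw [e, toCuCompletion_le_mk]
    exact fun u hu => hc u (hr.mono le_rfl hu h)

/-- The class of a sequence is the supremum of the images of its terms. -/
theorem isLUB_toCuCompletion (b : RelSeq hr) :
    IsLUB (Set.range fun n => toCuCompletion hr (b.1 n)) (CuCompletion.mk b) := by
  refine ⟨?_, fun u hu => ?_⟩
  · rintro _ ⟨n, rfl⟩
    exact toCuCompletion_le_mk.2 fun t ht => ⟨n, ht⟩
  · obtain ⟨c, rfl⟩ := CuCompletion.mk_surjective u
    rw [CuCompletion.mk_le_mk]
    exact fun k => toCuCompletion_le_mk.1 (hu ⟨k + 1, rfl⟩) _ (b.2 k)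

theorem monotone_toCuCompletion_seq (b : RelSeq hr) :
    Monotone fun n => toCuCompletion hr (b.1 n) :=
  isPomMor_toCuCompletion.monotone.comp b.mono

/-- Increasing sequences in `γ(S)` have suprema. All terms of all representing sequences form a
countable family directed by `≺`, and a `≺`-increasing sequence cofinal in it represents the
supremum; each of its terms lies below some member of the given sequence. -/
theorem CuCompletion.exists_isLUB {x : ℕ → CuCompletion hr} (hx : Monotone x) :
    ∃ c : RelSeq hr, IsLUB (Set.range x) (CuCompletion.mk c) ∧
      ∀ k, ∃ n, toCuCompletion hr (c.1 k) ≤ x n := by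
  choose a ha using fun n => CuCompletion.mk_surjective (x n)
  have hle : ∀ {i j}, i ≤ j → ∀ k, ∃ n, r ((a i).1 k) ((a j).1 n) := fun {i j} h => by
    rw [← CuCompletion.mk_le_mk, ha, ha]
    exact hx h
  let f : ℕ × ℕ → S := fun p => (a p.1).1 p.2
  have hf : Directed r f := by
    rintro ⟨i, k⟩ ⟨j, l⟩
    obtain ⟨m, hm⟩ := hle (le_max_left i j) k
    obtain ⟨n, hn⟩ := hle (le_max_right i j) l
    exact ⟨(max i j, max m n), hr.mono le_rfl hm ((a _).mono (le_max_left ..)),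
      hr.mono le_rfl hn ((a _).mono (le_max_right ..))⟩
  obtain ⟨c, hc⟩ : ∃ c : RelSeq hr, ∀ n, c.1 n = f (hf.sequence f n) :=
    ⟨⟨fun n => f (hf.sequence f n), fun n => hf.sequence_mono_nat n⟩, fun _ => rfl⟩
  refine ⟨c, ⟨?_, fun u hu => ?_⟩, fun k => ⟨(hf.sequence f k).1, ?_⟩⟩
  · rintro _ ⟨n, rfl⟩
    rw [← ha, CuCompletion.mk_le_mk]
    exact fun k => ⟨_, (hc _).symm ▸ hf.rel_sequence (n, k)⟩
  · obtain ⟨d, rfl⟩ := CuCompletion.mk_surjective u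
    rw [CuCompletion.mk_le_mk]
    intro k
    have h := hu ⟨(hf.sequence f k).1, rfl⟩
    rw [← ha, CuCompletion.mk_le_mk] at h
    rw [hc]
    exact h _
  · rw [← ha, hc]
    exact (isLUB_toCuCompletion _).1 ⟨_, rfl⟩

/-- Compact containment in `γ(S)`: for the converse, the supremum of a sequence is represented by
terms that already lie below its members, so `α(bₙ)` is reached at a finite stage. -/
theorem CuCompletion.compactlyContained_mk_iff {x : CuCompletion hr} {b : RelSeq hr} :
    CompactlyContained x (CuCompletion.mk b) ↔ ∃ n, x ≤ toCuCompletion hr (b.1 n) := by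
  refine ⟨fun h => h _ _ (monotone_toCuCompletion_seq b) (isLUB_toCuCompletion b) le_rfl, ?_⟩
  rintro ⟨n, hn⟩ c s hc hs hle
  obtain ⟨d, hd, hdc⟩ := CuCompletion.exists_isLUB hc
  rw [hs.unique hd, CuCompletion.mk_le_mk] at hle
  obtain ⟨m, hm⟩ := hle n
  obtain ⟨k, hk⟩ := hdc m
  exact ⟨k, (hn.trans (isPomMor_toCuCompletion.monotone (hr.le hm))).trans hk⟩

instance : IsCuSemigroup (CuCompletion hr) where
  o1 _ ha := by
    obtain ⟨c, hc, -⟩ := CuCompletion.exists_isLUB ha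
    exact ⟨_, hc⟩
  o2 x := by
    obtain ⟨b, rfl⟩ := CuCompletion.mk_surjective x
    refine ⟨_, fun k => ?_, isLUB_toCuCompletion b⟩
    obtain ⟨c, e, -, hc⟩ := exists_toCuCompletion_eq_mk hr (b.1 (k + 1))
    obtain ⟨n, hn⟩ := hc _ (b.2 k)
    simp only [e]
    exact CuCompletion.compactlyContained_mk_iff.2
      ⟨n, isPomMor_toCuCompletion.monotone (hr.le hn)⟩
  o3 {x' x y' y} hx hy := by
    obtain ⟨a, rfl⟩ := CuCompletion.mk_surjective x
    obtain ⟨b, rfl⟩ := CuCompletion.mk_surjective y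
    obtain ⟨i, hi⟩ := CuCompletion.compactlyContained_mk_iff.1 hx
    obtain ⟨j, hj⟩ := CuCompletion.compactlyContained_mk_iff.1 hy
    rw [← map_add]
    exact CuCompletion.compactlyContained_mk_iff.2 ⟨max i j, (add_le_add
      (hi.trans (monotone_toCuCompletion_seq a (le_max_left ..)))
      (hj.trans (monotone_toCuCompletion_seq b (le_max_right ..)))).trans_eq
        (isPomMor_toCuCompletion.map_add _ _).symm⟩
  o4 {x y s t} hx hy hs ht := by
    refine ⟨?_, fun u hu => ?_⟩
    · rintro _ ⟨n, rfl⟩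
      exact add_le_add (hs.1 ⟨n, rfl⟩) (ht.1 ⟨n, rfl⟩)
    · obtain ⟨a, rfl⟩ := CuCompletion.mk_surjective s
      obtain ⟨b, rfl⟩ := CuCompletion.mk_surjective t
      rw [← map_add]
      refine (isLUB_toCuCompletion (a + b)).2 ?_
      rintro _ ⟨k, rfl⟩
      obtain ⟨i, hi⟩ := CuCompletion.compactlyContained_mk_iff.2 ⟨k, le_rfl⟩ x _ hx hs le_rfl
      obtain ⟨j, hj⟩ := CuCompletion.compactlyContained_mk_iff.2 ⟨k, le_rfl⟩ y _ hy ht le_rfl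
      exact ((isPomMor_toCuCompletion.map_add _ _).trans_le (add_le_add
        (hi.trans (hx (le_max_left i j))) (hj.trans (hy (le_max_right i j))))).trans
          (hu ⟨max i j, rfl⟩)

variable (hr) in
theorem isWMor_toCuCompletion : IsWMor r CompactlyContained (toCuCompletion hr) where
  toIsPomMor := isPomMor_toCuCompletion
  cont s x h := by
    obtain ⟨a, e, ha, -⟩ := exists_toCuCompletion_eq_mk hr s
    rw [e, CuCompletion.compactlyContained_mk_iff] at h
    exact h.imp' a.1 fun n hn => ⟨ha n, hn⟩
  map_rel s' s h := by
    obtain ⟨a, e, -, hc⟩ := exists_toCuCompletion_eq_mk hr s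
    obtain ⟨n, hn⟩ := hc s' h
    rw [e]
    exact CuCompletion.compactlyContained_mk_iff.2
      ⟨n, isPomMor_toCuCompletion.monotone (hr.le hn)⟩

/-! ### The universal property of the Cu-completion -/

variable {R : Type w} [Pom R]

theorem IsGenCuMor.isLUB_comp_toCuCompletion {g : CuCompletion hr → R} (hg : IsGenCuMor g)
    (b : RelSeq hr) :
    IsLUB (Set.range fun n => g (toCuCompletion hr (b.1 n))) (g (CuCompletion.mk b)) :=
  hg.map_sup _ _ (monotone_toCuCompletion_seq b) (isLUB_toCuCompletion b)

theorem IsGenCuMor.le_of_comp_toCuCompletion_le {g₁ g₂ : CuCompletion hr → R}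
    (h₁ : IsGenCuMor g₁) (h₂ : IsGenCuMor g₂)
    (h : g₁ ∘ toCuCompletion hr ≤ g₂ ∘ toCuCompletion hr) : g₁ ≤ g₂ := fun x => by
  obtain ⟨b, rfl⟩ := CuCompletion.mk_surjective x
  refine (h₁.isLUB_comp_toCuCompletion b).2 ?_
  rintro _ ⟨n, rfl⟩
  exact (h _).trans ((h₂.isLUB_comp_toCuCompletion b).1 ⟨n, rfl⟩)

theorem morRel_comp_toCuCompletion_iff {g₁ g₂ : CuCompletion hr → R}
    (h₁ : IsPomMor g₁) (h₂ : IsPomMor g₂) :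
    MorRel r CompactlyContained (g₁ ∘ toCuCompletion hr) (g₂ ∘ toCuCompletion hr) ↔
      MorRel CompactlyContained CompactlyContained g₁ g₂ := by
  refine ⟨fun h x y k => ?_, fun h s' s k => h _ _ ((isWMor_toCuCompletion hr).map_rel s' s k)⟩
  obtain ⟨b, rfl⟩ := CuCompletion.mk_surjective y
  obtain ⟨n, hn⟩ := CuCompletion.compactlyContained_mk_iff.1 k
  exact isAuxiliary_compactlyContained.mono (h₁.monotone hn) (h _ _ (b.2 n))
    (h₂.monotone ((isLUB_toCuCompletion b).1 ⟨n + 1, rfl⟩))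

variable [IsCuSemigroup R]

/-- The extension of `f` sends the class of `(aₖ)` to the supremum of `f (aₖ)`. -/
theorem IsGenWMor.exists_extension {f : S → R} (hf : IsGenWMor r CompactlyContained f) :
    ∃ g : CuCompletion hr → R, IsGenCuMor g ∧ f = g ∘ toCuCompletion hr := by
  -- Mutually cofinal sequences have images with the same supremum, so the value depends only on
  -- the class.
  have hex : ∀ x : CuCompletion hr, ∃ v, ∀ a : RelSeq hr, CuCompletion.mk a = x →
      IsLUB (Set.range fun k => f (a.1 k)) v := fun x => by
    obtain ⟨a, rfl⟩ := CuCompletion.mk_surjective x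
    obtain ⟨v, hv⟩ := IsCuSemigroup.o1 _ (hf.monotone.comp a.mono)
    refine ⟨v, fun b hb => ⟨?_, fun u hu => hv.2 ?_⟩⟩
    · rintro _ ⟨k, rfl⟩
      obtain ⟨n, hn⟩ := CuCompletion.mk_le_mk.1 hb.le k
      exact (hf.monotone (hr.le hn)).trans (hv.1 ⟨n, rfl⟩)
    · rintro _ ⟨k, rfl⟩
      obtain ⟨n, hn⟩ := CuCompletion.mk_le_mk.1 hb.ge k
      exact (hf.monotone (hr.le hn)).trans (hu ⟨n, rfl⟩)
  choose g hg using hex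
  have hlub : ∀ a : RelSeq hr, IsLUB (Set.range fun k => f (a.1 k)) (g (CuCompletion.mk a)) :=
    fun a => hg _ a rfl
  have hcomp : f = g ∘ toCuCompletion hr := funext fun s => by
    obtain ⟨a, e, ha, hc⟩ := exists_toCuCompletion_eq_mk hr s
    rw [Function.comp_apply, e]
    refine IsLUB.unique ⟨?_, fun u hu => le_of_forall_compactlyContained_le fun x hx => ?_⟩
      (hlub a)
    · rintro _ ⟨k, rfl⟩
      exact hf.monotone (hr.le (ha k))
    · obtain ⟨s', hs, l⟩ := hf.cont s x hx
      obtain ⟨k, hk⟩ := hc s' hs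
      exact l.trans ((hf.monotone (hr.le hk)).trans (hu ⟨k, rfl⟩))
  have hmono : Monotone g := fun x y h => by
    obtain ⟨a, rfl⟩ := CuCompletion.mk_surjective x
    obtain ⟨b, rfl⟩ := CuCompletion.mk_surjective y
    refine (hlub a).2 ?_
    rintro _ ⟨k, rfl⟩
    obtain ⟨n, hn⟩ := CuCompletion.mk_le_mk.1 h k
    exact (hf.monotone (hr.le hn)).trans ((hlub b).1 ⟨n, rfl⟩)
  refine ⟨g, ⟨⟨?_, fun x y => ?_, hmono⟩, fun x s hx hs => ⟨?_, fun u hu => ?_⟩⟩, hcomp⟩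
  · have h := congrFun hcomp 0
    rw [hf.map_zero, Function.comp_apply, isPomMor_toCuCompletion.map_zero] at h
    exact h.symm
  · obtain ⟨a, rfl⟩ := CuCompletion.mk_surjective x
    obtain ⟨b, rfl⟩ := CuCompletion.mk_surjective y
    have h := IsCuSemigroup.o4 (hf.monotone.comp a.mono) (hf.monotone.comp b.mono) (hlub a) (hlub b)
    have h' := hlub (a + b)
    rw [map_add] at h'
    refine h'.unique ?_
    convert h using 2
    exact funext fun k => hf.map_add _ _
  · rintro _ ⟨n, rfl⟩
    exact hmono (hs.1 ⟨n, rfl⟩)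
  · obtain ⟨b, rfl⟩ := CuCompletion.mk_surjective s
    refine (hlub b).2 ?_
    rintro _ ⟨k, rfl⟩
    -- `α(bₖ)` is compactly contained in the supremum, hence below some member of the sequence.
    obtain ⟨n, hn⟩ := CuCompletion.compactlyContained_mk_iff.2 ⟨k, le_rfl⟩ x _ hx hs le_rfl
    exact (congrFun hcomp _).trans_le ((hmono hn).trans (hu ⟨n, rfl⟩))

theorem IsWMor.exists_extension {f : S → R} (hf : IsWMor r CompactlyContained f) :
    ∃ g : CuCompletion hr → R, IsCuMor g ∧ f = g ∘ toCuCompletion hr := by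
  obtain ⟨g, hg, rfl⟩ := hf.toIsGenWMor.exists_extension (hr := hr)
  exact ⟨g, ⟨hg, (morRel_comp_toCuCompletion_iff hg.toIsPomMor hg.toIsPomMor).1 hf.map_rel⟩, rfl⟩

variable (hr) in
theorem isCuCompletion_toCuCompletion : IsCuCompletion.{u, u, w} r (toCuCompletion hr) := by
  refine ⟨inferInstance, isWMor_toCuCompletion hr, fun R _ _ f hf => ?_⟩
  obtain ⟨g, hg, rfl⟩ := hf.exists_extension (hr := hr)
  refine ⟨g, ⟨hg, rfl⟩, fun g' ⟨hg', e⟩ => le_antisymm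
    (hg'.toIsGenCuMor.le_of_comp_toCuCompletion_le hg.toIsGenCuMor e.ge)
    (hg.toIsGenCuMor.le_of_comp_toCuCompletion_le hg'.toIsGenCuMor e.le)⟩

end Completion

/-! ### Precomposition as an isomorphism of ordered monoids -/

section Precomp

variable {X : Type u} {Y : Type v} {R : Type w} [Pom R]

/-- Precomposition with `p : Y → X`, as an isomorphism of ordered monoids between submonoids `A`
of `X → R` and `B` of `Y → R`. -/
noncomputable def precompOrderAddIso (A : AddSubmonoid (X → R)) (B : AddSubmonoid (Y → R))
    (p : Y → X) (hp : ∀ g ∈ A, g ∘ p ∈ B) (hex : ∀ f ∈ B, ∃ g ∈ A, f = g ∘ p)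
    (hle : ∀ g₁ ∈ A, ∀ g₂ ∈ A, g₁ ∘ p ≤ g₂ ∘ p → g₁ ≤ g₂) : A ≃+o B where
  toFun g := ⟨g.1 ∘ p, hp g.1 g.2⟩
  invFun f := ⟨(hex f.1 f.2).choose, (hex f.1 f.2).choose_spec.1⟩
  left_inv g := by
    have h := (hex _ (hp g.1 g.2)).choose_spec
    exact Subtype.ext (le_antisymm (hle _ h.1 _ g.2 h.2.ge) (hle _ g.2 _ h.1 h.2.le))
  right_inv f := Subtype.ext (hex f.1 f.2).choose_spec.2.symm
  map_add' _ _ := rfl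
  map_le_map_iff' {g₁ g₂} := ⟨hle _ g₁.2 _ g₂.2, fun h y => h (p y)⟩

end Precomp

/-! ### The tensor product of Cu-semigroups -/

section CuTensor

variable {S : Type u} {T : Type v} [Pom S] [Pom T] {R : Type w} [Pom R]
  (hW : IsPreW (TensorRel (CompactlyContained (S := S)) (CompactlyContained (S := T))))

theorem IsGenCuMor.le_of_comp_cuTensorMap_le {g₁ g₂ : CuCompletion hW → R} (h₁ : IsGenCuMor g₁)
    (h₂ : IsGenCuMor g₂) (h : g₁ ∘ cuTensorMap hW ≤ g₂ ∘ cuTensorMap hW) : g₁ ≤ g₂ :=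
  h₁.le_of_comp_toCuCompletion_le h₂
    ((h₁.toIsPomMor.comp isPomMor_toCuCompletion).le_of_comp_pomTensorMap_le
      (h₂.toIsPomMor.comp isPomMor_toCuCompletion) h)

variable [IsCuSemigroup S] [IsCuSemigroup T]

theorem isCuBimor_cuTensorMap : IsCuBimor (cuTensorMap hW) := by
  have h := (isWMor_toCuCompletion hW).comp_bimor
    (isWBimor_pomTensorMap (isPreW_compactlyContained S) (isPreW_compactlyContained T))
  exact ⟨isGenCuBimor_iff.2 h.toIsGenWBimor, h.map_rel⟩

variable [IsCuSemigroup R]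

theorem bimorRel_comp_cuTensorMap_iff {g₁ g₂ : CuCompletion hW → R} (h₁ : IsPomMor g₁)
    (h₂ : IsPomMor g₂) :
    BimorRel CompactlyContained CompactlyContained CompactlyContained
        (g₁ ∘ cuTensorMap hW) (g₂ ∘ cuTensorMap hW) ↔
      MorRel CompactlyContained CompactlyContained g₁ g₂ :=
  (bimorRel_comp_pomTensorMap_iff (isPreW_compactlyContained S) (isPreW_compactlyContained T)
    (isPreW_compactlyContained R) (h₁.comp isPomMor_toCuCompletion)
    (h₂.comp isPomMor_toCuCompletion)).trans (morRel_comp_toCuCompletion_iff h₁ h₂)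

theorem IsGenCuBimor.exists_lift {f : S × T → R} (hf : IsGenCuBimor f) :
    ∃ g : CuCompletion hW → R, IsGenCuMor g ∧ f = g ∘ cuTensorMap hW := by
  obtain ⟨g, hg, rfl⟩ := (isGenCuBimor_iff.1 hf).exists_lift (isPreW_compactlyContained S)
    (isPreW_compactlyContained T) (isPreW_compactlyContained R)
  obtain ⟨g', hg', rfl⟩ := hg.exists_extension (hr := hW)
  exact ⟨g', hg', rfl⟩

theorem IsCuBimor.exists_lift {f : S × T → R} (hf : IsCuBimor f) :
    ∃ g : CuCompletion hW → R, IsCuMor g ∧ f = g ∘ cuTensorMap hW := by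
  obtain ⟨g, hg, rfl⟩ := hf.toIsGenCuBimor.exists_lift hW
  exact ⟨g, ⟨hg, (bimorRel_comp_cuTensorMap_iff hW hg.toIsPomMor hg.toIsPomMor).1 hf.map_rel⟩, rfl⟩

end CuTensor

/-! ### The representation theorem -/

theorem mainTheorem1 {S : Type u} {T : Type v} [Pom S] [Pom T] :
    -- the tensor product of PreW-semigroups `(S, rS)` and `(T, rT)`
    (∀ (rS : S → S → Prop) (rT : T → T → Prop) (hS : IsPreW rS) (hT : IsPreW rT),
      ∃ hW : IsPreW (TensorRel rS rT),
        IsWBimor rS rT (TensorRel rS rT) (pomTensorMap S T) ∧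
        (∀ (R : Type w) [Pom R] (rR : R → R → Prop), IsPreW rR →
          (∀ f : S × T → R, IsGenWBimor rS rT rR f →
            ∃ g : PomTensor S T → R, IsGenWMor (TensorRel rS rT) rR g ∧ f = g ∘ pomTensorMap S T) ∧
          (∀ f : S × T → R, IsWBimor rS rT rR f →
            ∃ g : PomTensor S T → R, IsWMor (TensorRel rS rT) rR g ∧ f = g ∘ pomTensorMap S T) ∧
          (∀ g₁ g₂ : PomTensor S T → R,
            IsGenWMor (TensorRel rS rT) rR g₁ → IsGenWMor (TensorRel rS rT) rR g₂ →
              (g₁ ∘ pomTensorMap S T ≤ g₂ ∘ pomTensorMap S T ↔ g₁ ≤ g₂)) ∧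
          (∀ g₁ g₂ : PomTensor S T → R,
            IsGenWMor (TensorRel rS rT) rR g₁ → IsGenWMor (TensorRel rS rT) rR g₂ →
              (BimorRel rS rT rR (g₁ ∘ pomTensorMap S T) (g₂ ∘ pomTensorMap S T) ↔
                MorRel (TensorRel rS rT) rR g₁ g₂))) ∧
        (∀ (R : Type w) [Pom R] (rR : R → R → Prop) (hR : IsPreW rR),
          ∃ Φ : GenWMor hW hR ≃+o GenWBimor hS hT hR,
            (∀ g, (Φ g : S × T → R) = (g : PomTensor S T → R) ∘ pomTensorMap S T) ∧
            ∀ g₁ g₂, BimorRel rS rT rR (Φ g₁ : S × T → R) (Φ g₂) ↔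
              MorRel (TensorRel rS rT) rR (g₁ : PomTensor S T → R) g₂) ∧
        ∃ Φ : ∀ (R : Type w) [Pom R] (rR : R → R → Prop) (hR : IsPreW rR),
            WMor hW hR ≃+o WBimor hS hT hR,
          (∀ (R : Type w) [Pom R] (rR : R → R → Prop) (hR : IsPreW rR) (g : WMor hW hR),
            (Φ R rR hR g : S × T → R) = (g : PomTensor S T → R) ∘ pomTensorMap S T) ∧
          ∀ (R R' : Type w) [Pom R] [Pom R'] (rR : R → R → Prop) (rR' : R' → R' → Prop)
            (hR : IsPreW rR) (hR' : IsPreW rR') (h : WMor hR hR') (g : WMor hW hR),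
            Φ R' rR' hR' (WMor.post hW h g) = WBimor.post hS hT h (Φ R rR hR g)) ∧
    -- the tensor product of Cu-semigroups `S` and `T`
    (∀ [IsCuSemigroup S] [IsCuSemigroup T],
      ∃ hW : IsPreW (TensorRel (CompactlyContained (S := S)) (CompactlyContained (S := T))),
        IsCuSemigroup (CuCompletion hW) ∧
        IsCuCompletion.{max u v, max u v, w}
          (TensorRel (CompactlyContained (S := S)) (CompactlyContained (S := T)))
          (toCuCompletion hW) ∧
        IsCuBimor (cuTensorMap hW) ∧
        (∀ (R : Type w) [Pom R] [IsCuSemigroup R],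
          (∀ f : S × T → R, IsGenCuBimor f →
            ∃ g : CuCompletion hW → R, IsGenCuMor g ∧ f = g ∘ cuTensorMap hW) ∧
          (∀ f : S × T → R, IsCuBimor f →
            ∃ g : CuCompletion hW → R, IsCuMor g ∧ f = g ∘ cuTensorMap hW) ∧
          (∀ g₁ g₂ : CuCompletion hW → R, IsGenCuMor g₁ → IsGenCuMor g₂ →
            (g₁ ∘ cuTensorMap hW ≤ g₂ ∘ cuTensorMap hW ↔ g₁ ≤ g₂)) ∧
          (∀ g₁ g₂ : CuCompletion hW → R, IsGenCuMor g₁ → IsGenCuMor g₂ →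
            (BimorRel CompactlyContained CompactlyContained CompactlyContained
                (g₁ ∘ cuTensorMap hW) (g₂ ∘ cuTensorMap hW) ↔
              MorRel CompactlyContained CompactlyContained g₁ g₂))) ∧
        (∀ (R : Type w) [Pom R] [IsCuSemigroup R],
          ∃ Φ : GenCuMor (CuCompletion hW) R ≃+o GenCuBimor S T R,
            (∀ g, (Φ g : S × T → R) = (g : CuCompletion hW → R) ∘ cuTensorMap hW) ∧
            ∀ g₁ g₂, BimorRel CompactlyContained CompactlyContained CompactlyContained
                (Φ g₁ : S × T → R) (Φ g₂) ↔
              MorRel CompactlyContained CompactlyContained (g₁ : CuCompletion hW → R) g₂) ∧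
        ∃ Φ : ∀ (R : Type w) [Pom R] [IsCuSemigroup R],
            CuMor (CuCompletion hW) R ≃+o CuBimor S T R,
          (∀ (R : Type w) [Pom R] [IsCuSemigroup R] (g : CuMor (CuCompletion hW) R),
            (Φ R g : S × T → R) = (g : CuCompletion hW → R) ∘ cuTensorMap hW) ∧
          ∀ (R R' : Type w) [Pom R] [Pom R'] [IsCuSemigroup R] [IsCuSemigroup R']
            (h : CuMor R R') (g : CuMor (CuCompletion hW) R),
            Φ R' (CuMor.post (CuCompletion hW) h g) = CuBimor.post S T h (Φ R g)) := by
  refine ⟨fun rS rT hS hT => ⟨isPreW_tensorRel hS hT, isWBimor_pomTensorMap hS hT,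
    fun R _ rR hR => ⟨fun f hf => hf.exists_lift hS hT hR, fun f hf => hf.exists_lift hS hT hR,
      fun g₁ g₂ h₁ h₂ => ⟨h₁.toIsPomMor.le_of_comp_pomTensorMap_le h₂.toIsPomMor,
        fun h p => h _⟩,
      fun g₁ g₂ h₁ h₂ =>
        bimorRel_comp_pomTensorMap_iff hS hT hR h₁.toIsPomMor h₂.toIsPomMor⟩,
    fun R _ rR hR => ?_, ?_⟩, fun {_ _} => ?_⟩
  · exact ⟨precompOrderAddIso _ _ (pomTensorMap S T)
      (fun _ hg => IsGenWMor.comp_bimor hg (isWBimor_pomTensorMap hS hT).toIsGenWBimor)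
      (fun _ hf => IsGenWBimor.exists_lift hS hT hR hf)
      (fun _ h₁ _ h₂ => IsPomMor.le_of_comp_pomTensorMap_le h₁.toIsPomMor h₂.toIsPomMor),
      fun _ => rfl, fun g₁ g₂ =>
        bimorRel_comp_pomTensorMap_iff hS hT hR g₁.2.toIsPomMor g₂.2.toIsPomMor⟩
  · exact ⟨fun R _ rR hR => precompOrderAddIso _ _ (pomTensorMap S T)
      (fun _ hg => IsWMor.comp_bimor hg (isWBimor_pomTensorMap hS hT))
      (fun _ hf => IsWBimor.exists_lift hS hT hR hf)
      (fun _ h₁ _ h₂ => IsPomMor.le_of_comp_pomTensorMap_le h₁.toIsPomMor h₂.toIsPomMor),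
      fun _ _ _ _ _ => rfl, fun _ _ _ _ _ _ _ _ _ _ => rfl⟩
  · have hW := isPreW_tensorRel (isPreW_compactlyContained S) (isPreW_compactlyContained T)
    refine ⟨hW, inferInstance, isCuCompletion_toCuCompletion hW, isCuBimor_cuTensorMap hW,
      fun R _ _ => ⟨fun f hf => hf.exists_lift hW, fun f hf => hf.exists_lift hW,
        fun g₁ g₂ h₁ h₂ => ⟨h₁.le_of_comp_cuTensorMap_le hW h₂, fun h p => h _⟩,
        fun g₁ g₂ h₁ h₂ => bimorRel_comp_cuTensorMap_iff hW h₁.toIsPomMor h₂.toIsPomMor⟩,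
      fun R _ _ => ?_, ?_⟩
    · exact ⟨precompOrderAddIso _ _ (cuTensorMap hW)
        (fun _ hg => IsGenCuMor.comp_bimor hg (isCuBimor_cuTensorMap hW).toIsGenCuBimor)
        (fun _ hf => IsGenCuBimor.exists_lift hW hf)
        (fun _ h₁ _ h₂ => IsGenCuMor.le_of_comp_cuTensorMap_le hW h₁ h₂),
        fun _ => rfl, fun g₁ g₂ =>
          bimorRel_comp_cuTensorMap_iff hW g₁.2.toIsPomMor g₂.2.toIsPomMor⟩
    · exact ⟨fun R _ _ => precompOrderAddIso _ _ (cuTensorMap hW)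
        (fun _ hg =>
          ⟨IsGenCuMor.comp_bimor hg.toIsGenCuMor (isCuBimor_cuTensorMap hW).toIsGenCuBimor,
          (bimorRel_comp_cuTensorMap_iff hW hg.toIsPomMor hg.toIsPomMor).2 hg.map_rel⟩)
        (fun _ hf => IsCuBimor.exists_lift hW hf)
        (fun _ h₁ _ h₂ =>
          IsGenCuMor.le_of_comp_cuTensorMap_le hW h₁.toIsGenCuMor h₂.toIsGenCuMor),
        fun _ _ _ _ => rfl, fun _ _ _ _ _ _ _ _ => rfl⟩
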